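/- Let $K$ be a field. For simple graphs $G_1$ on $[m]$ and $G_2$ on $[n]$, let $X=(x_{ij})$ be an $m\times n$ matrix of indeterminates and let $J_{G_1,G_2}\subseteq K[x_{ij}: 1\le i\le m,\ 1\le j\le n]$ be the ideal generated by the $2$-minors $x_{ik}x_{jl}-x_{il}x_{jk}$ with $\{i,j\}\in E(G_1)$ and $\{k,l\}\in E(G_2)$. An ideal $I$ of a Noetherian ring $S$ is called unmixed if all associated primes of $S/I$ have the same height. The join $G*G'$ of two graphs on disjoint vertex sets is obtained from their disjoint union $G\sqcup G'$ by adding all edges between the vertices of $G$ and those of $G'$. For a graph $G$ and a set $T$ of vertices of $G$, let $c_G(T)$ be the number of connected components of the graph $G-T$ obtained by deleting $T$. A vertex is a cut point of a graph if its deletion increases the number of connected components. Let $\mathcal C(G)$ be the collection consisting of $\emptyset$ and of all vertex sets $T$ of $G$ such that every $i\in T$ is a cut point of the subgraph of $G$ induced on $(V(G)\setminus T)\cup\{i\}$. Theorem. Let $G_1,H,H_1,\ldots,H_r$ be connected graphs on $m,t,n_1,\ldots,n_r$ vertices, respectively, where $r\ge 2$ and $2\le m\le t+\sum_{i=1}^r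 n_i$, and suppose that for each $i=1,\ldots,r$ either $n_i=1$ or $n_i\ge m$. Let $G_2:=H*(H_1\sqcup\cdots\sqcup H_r)$. Then $J_{G_1,G_2}$ is unmixed if and only if the following four conditions hold: (a) $J_{G_1,H_i}$ is unmixed for all $i=1,\ldots,r$; (b) $G_1$ is complete; (c) $t=(r-1)(m-1)$; (d) for every nonempty $T\in\mathcal C(H)$, $(c_H(T)-1)(m-1)=|T|+\sum_{i=1}^r n_i$. -/

import Mathlib

/-- An ideal is unmixed if all the associated primes of `R ⧸ I` have the same height. -/
def Ideal.IsUnmixed {R : Type*} [CommRing R] (I : Ideal R) : Prop :=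
  ∀ p ∈ associatedPrimes R (R ⧸ I), ∀ q ∈ associatedPrimes R (R ⧸ I), p.height = q.height

namespace SimpleGraph

/-- The binomial edge ideal `J_{G₁,G₂}` of a pair of graphs, in the polynomial ring over `K` in the
entries of the generic `V × W` matrix: it is generated by the 2-minors `[i, j | k, l]` with `{i, j}`
an edge of `G₁` and `{k, l}` an edge of `G₂`. (Exchanging `i, j` or `k, l` only changes the sign.) -/
noncomputable def pairBinomialEdgeIdeal (K : Type*) [Field K] {V W : Type*}
    (G₁ : SimpleGraph V) (G₂ : SimpleGraph W) : Ideal (MvPolynomial (V × W) K) :=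
  Ideal.span {f | ∃ i j k l, G₁.Adj i j ∧ G₂.Adj k l ∧
    f = MvPolynomial.X (i, k) * MvPolynomial.X (j, l)
      - MvPolynomial.X (i, l) * MvPolynomial.X (j, k)}

/-- The join `G * H` on the disjoint union of the vertex sets. -/
def joinGraph {V W : Type*} (G : SimpleGraph V) (H : SimpleGraph W) : SimpleGraph (V ⊕ W) :=
  (G ⊕g H) ⊔ completeBipartiteGraph V W

/-- The disjoint union of a family of graphs. -/
def sigmaGraph {ι : Type*} {V : ι → Type*} (H : ∀ i, SimpleGraph (V i)) :
    SimpleGraph (Σ i, V i) :=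
  ⨆ i, (H i).map (Function.Embedding.sigmaMk i)

/-- The number of connected components. -/
noncomputable def numComponents {V : Type*} (G : SimpleGraph V) : ℕ :=
  Nat.card G.ConnectedComponent

/-- `c_G(T)`: the number of connected components of `G` after the deletion of `T`. -/
noncomputable def numComponentsAfter {V : Type*} (G : SimpleGraph V) (T : Finset V) : ℕ :=
  (G.induce {v | v ∉ T}).numComponents

/-- A vertex whose deletion increases the number of connected components. -/
def IsCutPoint {V : Type*} (G : SimpleGraph V) (v : V) : Prop :=
  G.numComponents < (G.induce {w | w ≠ v}).numComponents

/-- `T` has the cut point property: every `i ∈ T` is a cut point of the subgraph of `G` induced on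
`(V \ T) ∪ {i}`. -/
def HasCutPointProperty {V : Type*} (G : SimpleGraph V) (T : Finset V) : Prop :=
  ∀ i ∈ T, (G.induce {v | v ∉ T ∨ v = i}).IsCutPoint ⟨i, Or.inr rfl⟩

/-- The collection `𝒞(G)` of the empty set and all vertex sets with the cut point property. -/
def cutPointSets {V : Type*} (G : SimpleGraph V) : Set (Finset V) :=
  {∅} ∪ {T | G.HasCutPointProperty T}

end SimpleGraph

/-!
For complete `G₁`, a lattice-ideal argument writes `J_{G₁,G}` as the intersection of the primes
`P_T` of matrices whose columns in `T` vanish and whose rank is at most one on each component of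
`G - T`. These primes are parametrized by monomial maps, and explicit chains of primes give
`height P_T = |T| + (m - 1) (|V(G)| - c_G(T))`. Testing when deleting a vertex from `T` makes `P_T`
smaller shows that the minimal primes are the `P_T` with `T ∈ 𝒞(G)`, so that `J_{G₁,G}` is unmixed
if and only if `(c_G(T) - 1) (m - 1) = |T|` for all these `T`.

For connected `G₁` the `P_T` with `T ∈ 𝒞(G)` are still minimal primes of `J_{G₁,G}`, and so they
are with the two graphs exchanged. If `G₁` is not complete, some `S ∈ 𝒞(G₁)` has `c(S) ≥ 2`, and
then unmixedness forces `|V(G)| - 1 ≤ (c(S) - 1) (|V(G)| - 1) = |S| ≤ m - 2`, which is impossible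
for `m ≤ |V(G)|`.

In a join, a nonempty cut set contains all the vertices of one of the two graphs and induces a
disconnecting cut set of the other one; the cut sets of a disjoint union are the unions of cut sets
of its summands.
-/

namespace BinomialEdgeIdeal

open SimpleGraph MvPolynomial

/-! ### Heights of the kernels of block maps -/

section Chains

variable {α β : Type*} [DecidableEq α] [Preorder β] {F : Finset α → β} {s : Finset α}

theorem height_add_card_le (hF : ∀ A ⊆ s, ∀ a ∈ A, F A < F (A.erase a)) :
    Order.height (F s) + s.card ≤ Order.height (F ∅) := by
  induction s using Finset.induction_on with
  | empty => simp
  | insert a s ha ih =>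
    have hlt : F (insert a s) < F s := by
      simpa only [Finset.erase_insert ha] using hF _ subset_rfl a (Finset.mem_insert_self a s)
    calc Order.height (F (insert a s)) + (insert a s).card
        = (Order.height (F (insert a s)) + 1) + s.card := by
          rw [Finset.card_insert_of_notMem ha]; push_cast; ring
      _ ≤ Order.height (F s) + s.card := by gcongr; exact Order.height_add_one_le hlt
      _ ≤ Order.height (F ∅) := ih fun A hA => hF A (hA.trans (Finset.subset_insert a s))

theorem coheight_add_card_le (hF : ∀ A ⊆ s, ∀ a ∈ A, F (A.erase a) < F A) :
    Order.coheight (F s) + s.card ≤ Order.coheight (F ∅) :=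
  height_add_card_le (F := fun A => OrderDual.toDual (F A)) hF

theorem height_add_coheight_le_krullDim (a : β) :
    ((Order.height a + Order.coheight a : ℕ∞) : WithBot ℕ∞) ≤ Order.krullDim β := by
  have : Nonempty β := ⟨a⟩
  rw [Order.krullDim_eq_iSup_height_add_coheight_of_nonempty]
  exact_mod_cast le_iSup (fun a : β => Order.height a + Order.coheight a) a

theorem eq_natCast_of_add_le {a b : ℕ∞} {p q : ℕ} (ha : p ≤ a) (hb : q ≤ b)
    (hab : a + b ≤ (p + q : ℕ)) : a = p := by
  lift a to ℕ using fun h => by simp [h] at hab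
  lift b to ℕ using fun h => by simp [h] at hab
  norm_cast at *
  omega

theorem krullDim_primeSpectrum_mvPolynomial (K σ : Type*) [Field K] [Finite σ] :
    Order.krullDim (PrimeSpectrum (MvPolynomial σ K)) = ((Nat.card σ : ℕ∞) : WithBot ℕ∞) := by
  change ringKrullDim _ = _
  rw [MvPolynomial.ringKrullDim_of_isNoetherianRing, ringKrullDim_eq_zero_of_field, zero_add]
  rfl

end Chains

section Kill

variable {K σ : Type*} [Field K] [DecidableEq σ]

/-- The specialization of the variables in `B` to `0`. -/
noncomputable def kill (B : Finset σ) : MvPolynomial σ K →ₐ[K] MvPolynomial σ K :=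
  aeval fun q => if q ∈ B then 0 else X q

theorem kill_X (B : Finset σ) (q : σ) :
    kill B (X q : MvPolynomial σ K) = if q ∈ B then 0 else X q := by
  simp [kill]

theorem kill_kill {A B : Finset σ} (h : A ⊆ B) (f : MvPolynomial σ K) :
    kill B (kill A f) = kill B f := by
  suffices (kill B : MvPolynomial σ K →ₐ[K] _).comp (kill A) = kill B from
    DFunLike.congr_fun this f
  ext q
  by_cases hA : q ∈ A
  · simp [kill_X, hA, h hA]
  · simp [kill_X, hA]

variable {R : Type*} [CommRing R] [Algebra K R] (φ : R →ₐ[K] MvPolynomial σ K)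

/-- The kernel of `φ` followed by the specialization of the variables in `B` to `0`, as a point of
the prime spectrum; it grows with `B`, which is how chains of primes are produced. -/
noncomputable def kerKill (B : Finset σ) : PrimeSpectrum R :=
  ⟨RingHom.ker ((kill B).comp φ), RingHom.ker_isPrime _⟩

variable {φ}

theorem kerKill_lt {A B : Finset σ} (h : A ⊆ B) {f : R} (hA : kill A (φ f) ≠ 0)
    (hB : kill B (φ f) = 0) : kerKill φ A < kerKill φ B := by
  rw [← PrimeSpectrum.asIdeal_lt_asIdeal]
  refine SetLike.lt_iff_le_and_exists.mpr ⟨fun g hg => ?_, f, hB, hA⟩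
  change kill B (φ g) = 0
  rw [← kill_kill h, show kill A (φ g) = 0 from hg, map_zero]

end Kill

section BlockMap

variable (K : Type*) [Field K] (V : Type*) {W κ : Type*}

open Classical in
/-- The map that sends the columns of the generic matrix in `T` to zero and, for each label `k`,
replaces the remaining columns `j` with `c j = k` by a generic matrix of rank one. -/
noncomputable def blockMap (T : Finset W) (c : W → κ) :
    MvPolynomial (V × W) K →ₐ[K] MvPolynomial ((V × κ) ⊕ W) K :=
  aeval fun p => if p.2 ∈ T then 0 else X (.inl (p.1, c p.2)) * X (.inr p.2)

/-- `blockMap`, deformed by adding a new variable to every entry. -/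
noncomputable def deformedBlockMap (T : Finset W) (c : W → κ) :
    MvPolynomial (V × W) K →ₐ[K] MvPolynomial (((V × κ) ⊕ W) ⊕ (V × W)) K :=
  aeval fun p => rename .inl (blockMap K V T c (X p)) + X (.inr p)

variable {K V} {T : Finset W} {c : W → κ}

theorem blockMap_X_of_mem {j : W} (h : j ∈ T) (i : V) : blockMap K V T c (X (i, j)) = 0 := by
  simp [blockMap, h]

theorem blockMap_X_of_notMem {j : W} (h : j ∉ T) (i : V) :
    blockMap K V T c (X (i, j)) = X (.inl (i, c j)) * X (.inr j) := by
  simp [blockMap, h]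

section Deformation

variable [DecidableEq V] [DecidableEq W] [DecidableEq κ]

theorem kill_deformedBlockMap_X_of_mem (B : Finset (((V × κ) ⊕ W) ⊕ (V × W))) {j : W} (h : j ∈ T)
    (i : V) : kill B (deformedBlockMap K V T c (X (i, j))) =
      if .inr (i, j) ∈ B then 0 else X (.inr (i, j)) := by
  simp [deformedBlockMap, blockMap_X_of_mem h, kill_X]

theorem kill_deformedBlockMap_X_of_notMem (B : Finset (((V × κ) ⊕ W) ⊕ (V × W))) {j : W}
    (h : j ∉ T) (i : V) : kill B (deformedBlockMap K V T c (X (i, j))) =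
      (if .inl (.inl (i, c j)) ∈ B then 0 else X (.inl (.inl (i, c j)))) *
        (if .inl (.inr j) ∈ B then 0 else X (.inl (.inr j))) +
      if .inr (i, j) ∈ B then 0 else X (.inr (i, j)) := by
  simp [deformedBlockMap, blockMap_X_of_notMem h, kill_X]

variable [Fintype V] [Fintype W]

theorem kill_deformedBlockMap_minor {j r : W} (hj : j ∉ T) (hr : r ∉ T) (hrj : c r = c j)
    {i i₀ : V} {A : Finset (V × W)} (h₁ : (i₀, r) ∉ A) (h₂ : (i₀, j) ∉ A) (h₃ : (i, r) ∉ A) :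
    kill (Finset.disjSum ∅ Aᶜ) (deformedBlockMap K V T c
        (X (i, j) * X (i₀, r) - X (i, r) * X (i₀, j))) =
      (if (i, j) ∈ A then X (.inr (i, j)) else 0) *
        (X (.inl (.inl (i₀, c j))) * X (.inl (.inr r))) := by
  simp only [map_sub, map_mul, kill_deformedBlockMap_X_of_notMem _ hj,
    kill_deformedBlockMap_X_of_notMem _ hr, hrj, Finset.inl_mem_disjSum, Finset.inr_mem_disjSum,
    Finset.notMem_empty, Finset.mem_compl, h₁, h₂, h₃, not_false_eq_true, if_true, if_false,
    ite_not]
  ring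

theorem kerKill_deformedBlockMap_asIdeal :
    (kerKill (deformedBlockMap K V T c) (Finset.disjSum ∅ Finset.univ)).asIdeal =
      RingHom.ker (blockMap K V T c) := by
  have key : (kill (Finset.disjSum ∅ Finset.univ)).comp (deformedBlockMap K V T c) =
      (rename .inl).comp (blockMap K V T c) := by
    ext ⟨i, j⟩
    by_cases hj : j ∈ T
    · simp [kill_deformedBlockMap_X_of_mem _ hj, blockMap_X_of_mem hj]
    · simp [kill_deformedBlockMap_X_of_notMem _ hj, blockMap_X_of_notMem hj]
  ext f
  change ((kill (Finset.disjSum ∅ Finset.univ)).comp (deformedBlockMap K V T c)) f = 0 ↔ _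
  rw [key]
  exact map_eq_zero_iff _ (rename_injective _ Sum.inl_injective)

variable {R : Finset W}

theorem card_le_height_kerKill (hRT : Disjoint R T) (hR : ∀ j ∉ T, ∃ r ∈ R, c r = c j) (i₀ : V) :
    ((Fintype.card V * T.card + (Fintype.card V - 1) * (T ∪ R)ᶜ.card : ℕ) : ℕ∞) ≤
      Order.height (kerKill (deformedBlockMap K V T c) (Finset.disjSum ∅ Finset.univ)) := by
  set N : Finset (V × W) := Finset.univ ×ˢ T ∪ (Finset.univ.erase i₀) ×ˢ (T ∪ R)ᶜ with hN
  have hcard : N.card = Fintype.card V * T.card + (Fintype.card V - 1) * (T ∪ R)ᶜ.card := by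
    rw [hN, Finset.card_union_of_disjoint, Finset.card_product, Finset.card_product,
      Finset.card_erase_of_mem (Finset.mem_univ _), Finset.card_univ]
    exact Finset.disjoint_product.mpr (.inr (disjoint_compl_right.mono_left
      Finset.subset_union_left))
  have hmem (i : V) (j : W) : (i, j) ∈ N ↔ j ∈ T ∨ i ≠ i₀ ∧ j ∉ T ∧ j ∉ R := by simp [hN]
  have hchain := height_add_card_le (s := N)
    (F := fun A => kerKill (deformedBlockMap K V T c) (Finset.disjSum ∅ Aᶜ)) (by
    rintro A hA ⟨i, j⟩ hij
    have hsub : Finset.disjSum (∅ : Finset ((V × κ) ⊕ W)) Aᶜ ⊆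
        Finset.disjSum ∅ (A.erase (i, j))ᶜ :=
      Finset.disjSum_mono subset_rfl (Finset.compl_subset_compl.mpr (Finset.erase_subset _ _))
    rcases (hmem i j).mp (hA hij) with hj | ⟨_, hj, _⟩
    · refine kerKill_lt hsub (f := X (i, j)) ?_ ?_
      · simp [kill_deformedBlockMap_X_of_mem _ hj, hij]
      · simp [kill_deformedBlockMap_X_of_mem _ hj]
    obtain ⟨r, hr, hrj⟩ := hR j hj
    have hrT : r ∉ T := Finset.disjoint_left.mp hRT hr
    have h₁ : (i₀, r) ∉ A := fun h => by simpa [hrT] using (hmem _ _).mp (hA h)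
    have h₂ : (i₀, j) ∉ A := fun h => by simpa [hj] using (hmem _ _).mp (hA h)
    have h₃ : (i, r) ∉ A := fun h => by simpa [hrT, hr] using (hmem _ _).mp (hA h)
    refine kerKill_lt hsub (f := X (i, j) * X (i₀, r) - X (i, r) * X (i₀, j)) ?_ ?_
    · rw [kill_deformedBlockMap_minor hj hrT hrj h₁ h₂ h₃, if_pos hij]
      exact mul_ne_zero (X_ne_zero _) (mul_ne_zero (X_ne_zero _) (X_ne_zero _))
    · rw [kill_deformedBlockMap_minor hj hrT hrj] <;> simp [h₁, h₂, h₃])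
  simpa [hcard] using le_of_add_le_right hchain

theorem card_le_coheight_kerKill (hRT : Disjoint R T) (hcR : Set.InjOn c R) (i₀ : V) :
    ((Fintype.card V * R.card + (T ∪ R)ᶜ.card : ℕ) : ℕ∞) ≤
      Order.coheight (kerKill (deformedBlockMap K V T c) (Finset.disjSum ∅ Finset.univ)) := by
  let F (A : Finset (V × κ)) (B : Finset W) : PrimeSpectrum (MvPolynomial (V × W) K) :=
    kerKill (deformedBlockMap K V T c) ((A.disjSum B).disjSum Finset.univ)
  have hcols := coheight_add_card_le (F := F ∅) (s := (T ∪ R)ᶜ) (by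
    intro B hB j hj
    have hjT : j ∉ T := fun h => by simpa [h] using hB hj
    refine kerKill_lt (f := X (i₀, j)) (Finset.disjSum_mono
      (Finset.disjSum_mono subset_rfl (Finset.erase_subset _ _)) subset_rfl) ?_ ?_
    · simp [kill_deformedBlockMap_X_of_notMem _ hjT]
    · simp [kill_deformedBlockMap_X_of_notMem _ hjT, hj])
  have hentries := coheight_add_card_le (F := fun A => F A (T ∪ R)ᶜ)
    (s := Finset.univ ×ˢ R.image c) (by
    rintro A hA ⟨i, k⟩ hik
    obtain ⟨r, hr, rfl⟩ : ∃ r ∈ R, c r = k := by simpa using hA hik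
    have hrT : r ∉ T := Finset.disjoint_left.mp hRT hr
    refine kerKill_lt (f := X (i, r)) (Finset.disjSum_mono
      (Finset.disjSum_mono (Finset.erase_subset _ _) subset_rfl) subset_rfl) ?_ ?_
    · simp [kill_deformedBlockMap_X_of_notMem _ hrT, hr]
    · simp [kill_deformedBlockMap_X_of_notMem _ hrT, hr, hik])
  rw [Finset.card_product, Finset.card_image_of_injOn hcR, Finset.card_univ] at hentries
  rw [Nat.cast_add]
  exact le_trans (by gcongr; exact le_of_add_le_right hentries) hcols

end Deformation

theorem height_ker_blockMap [Fintype V] [Nonempty V] [Fintype W] [DecidableEq W] [DecidableEq κ]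
    (T : Finset W) (c : W → κ) :
    (RingHom.ker (blockMap K V T c)).height =
      (T.card + (Fintype.card V - 1) * (Fintype.card W - (Tᶜ.image c).card) : ℕ) := by
  classical
  obtain ⟨R, hRT, hcR, hR⟩ := Finset.exists_subset_injOn_image_eq_of_surjOn (f := c)
    (Tᶜ : Finset W) (Tᶜ.image c) (by simpa using Set.surjOn_image c _)
  replace hRT : Disjoint R T := Finset.disjoint_left.mpr fun r hr => by simpa using hRT hr
  have hrep (j : W) (hj : j ∉ T) : ∃ r ∈ R, c r = c j := by
    simpa [← hR] using Finset.mem_image_of_mem c (Finset.mem_compl.mpr hj)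
  have hW : T.card + R.card + (T ∪ R)ᶜ.card = Fintype.card W := by
    rw [← Finset.card_union_of_disjoint hRT.symm, Finset.card_add_card_compl]
  obtain ⟨m, hm⟩ : ∃ m, Fintype.card V = m + 1 :=
    Nat.exists_eq_succ_of_ne_zero (Fintype.card_ne_zero (α := V))
  let i₀ : V := Classical.arbitrary V
  have hdim := height_add_coheight_le_krullDim
    (kerKill (deformedBlockMap K V T c) (Finset.disjSum ∅ Finset.univ))
  rw [krullDim_primeSpectrum_mvPolynomial, WithBot.coe_le_coe, Nat.card_eq_fintype_card,
    Fintype.card_prod, ← hW] at hdim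
  rw [← kerKill_deformedBlockMap_asIdeal, PrimeSpectrum.height_eq_orderHeight,
    eq_natCast_of_add_le (card_le_height_kerKill hRT hrep i₀) (card_le_coheight_kerKill hRT hcR i₀)
      (hdim.trans_eq ?_), ← hR, Finset.card_image_of_injOn hcR, ← hW]
  · rw [hm, Nat.add_sub_cancel, show T.card + R.card + (T ∪ R)ᶜ.card - R.card =
      T.card + (T ∪ R)ᶜ.card by omega]
    congr 1
    ring
  · rw [hm, Nat.add_sub_cancel]
    congr 1
    ring

end BlockMap

/-! ### The ideal of a complete graph as an intersection of primes -/

section Monomials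

variable {K : Type*} [Field K] {V W κ : Type*}

/-- The exponent of the image under `blockMap` of a monomial in the variables outside the columns
that are sent to zero. -/
noncomputable def blockDegree (c : W → κ) : (V × W →₀ ℕ) →ₗ[ℕ] ((V × κ) ⊕ W →₀ ℕ) :=
  Finsupp.linearCombination ℕ fun p =>
    Finsupp.single (.inl (p.1, c p.2)) 1 + Finsupp.single (.inr p.2) 1

variable {T : Finset W} {c : W → κ} {u v : V × W →₀ ℕ}

theorem blockDegree_single (p : V × W) : blockDegree c (Finsupp.single p 1) =
    Finsupp.single (.inl (p.1, c p.2)) 1 + Finsupp.single (.inr p.2) 1 := by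
  simp [blockDegree]

theorem blockDegree_apply_ne_zero {q : (V × κ) ⊕ W} :
    blockDegree c v q ≠ 0 ↔ ∃ p, v p ≠ 0 ∧ (.inl (p.1, c p.2) = q ∨ .inr p.2 = q) := by
  classical
  simp only [blockDegree, Finsupp.linearCombination_apply, Finsupp.sum, Finsupp.finsetSum_apply,
    ne_eq, Finset.sum_eq_zero_iff, not_forall, Finsupp.mem_support_iff, exists_prop]
  refine exists_congr fun p => and_congr_right fun hp => ?_
  simp [Finsupp.single_apply, hp, imp_iff_not_or]

theorem blockDegree_inl_ne_zero {i : V} {k : κ} :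
    blockDegree c v (.inl (i, k)) ≠ 0 ↔ ∃ j, c j = k ∧ v (i, j) ≠ 0 := by
  simp [blockDegree_apply_ne_zero, and_comm]

theorem blockDegree_inr_ne_zero {j : W} :
    blockDegree c v (.inr j) ≠ 0 ↔ ∃ i, v (i, j) ≠ 0 := by
  simp [blockDegree_apply_ne_zero]

theorem blockMap_monomial_of_notMem (hv : ∀ p, v p ≠ 0 → p.2 ∉ T) (a : K) :
    blockMap K V T c (monomial v a) = monomial (blockDegree c v) a := by
  have key : (v.prod fun p n => blockMap K V T c (X p) ^ n) = monomial (blockDegree c v) 1 := by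
    rw [blockDegree, Finsupp.linearCombination_apply, Finsupp.sum, monomial_sum_one]
    refine Finset.prod_congr rfl fun p hp => ?_
    obtain ⟨i, j⟩ := p
    simp only [blockMap_X_of_notMem (hv _ (Finsupp.mem_support_iff.mp hp))]
    simp [X, monomial_mul, monomial_pow]
  rw [monomial_eq, map_mul, ← algebraMap_eq, AlgHom.commutes, Finsupp.prod, map_prod]
  simp only [map_pow]
  rw [← Finsupp.prod, key, algebraMap_eq, C_mul_monomial, mul_one]

theorem blockMap_monomial_of_mem {p : V × W} (hp : v p ≠ 0) (hpT : p.2 ∈ T) (a : K) :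
    blockMap K V T c (monomial v a) = 0 := by
  rw [monomial_eq, map_mul, Finsupp.prod, map_prod,
    Finset.prod_eq_zero (Finsupp.mem_support_iff.mpr hp), mul_zero]
  rw [map_pow, blockMap_X_of_mem hpT, zero_pow hp]

theorem exists_blockDegree_eq_of_mem_ker {f : MvPolynomial (V × W) K}
    (hf : f ∈ RingHom.ker (blockMap K V T c)) (hu : u ∈ f.support) (huT : ∀ p, u p ≠ 0 → p.2 ∉ T) :
    ∃ v ∈ f.support, v ≠ u ∧ blockDegree c v = blockDegree c u := by
  classical
  by_contra! hne
  have hcoeff : coeff (blockDegree c u) (blockMap K V T c f) = coeff u f := by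
    conv_lhs => rw [f.as_sum]
    rw [map_sum, coeff_sum, Finset.sum_eq_single_of_mem u hu,
      blockMap_monomial_of_notMem huT, coeff_monomial, if_pos rfl]
    intro v hv hvu
    by_cases hvT : ∀ p, v p ≠ 0 → p.2 ∉ T
    · rw [blockMap_monomial_of_notMem hvT, coeff_monomial, if_neg (hne v hv hvu)]
    · push Not at hvT
      obtain ⟨p, hp, hpT⟩ := hvT
      rw [blockMap_monomial_of_mem hp hpT, coeff_zero]
  rw [RingHom.mem_ker.mp hf, coeff_zero] at hcoeff
  exact mem_support_iff.mp hu hcoeff.symm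

theorem exists_eq_add_single {σ : Type*} {u : σ →₀ ℕ} {p : σ} (h : u p ≠ 0) :
    ∃ v, u = v + Finsupp.single p 1 :=
  ⟨u - .single p 1, (tsub_add_cancel_of_le (by simpa [Nat.one_le_iff_ne_zero])).symm⟩

theorem card_support_sub_lt {σ : Type*} {f : MvPolynomial σ K} {u v : σ →₀ ℕ}
    (hu : u ∈ f.support) (hv : v ∈ f.support) (huv : v ≠ u) :
    (f - C (coeff u f) * (monomial u 1 - monomial v 1)).support.card < f.support.card := by
  classical
  refine Finset.card_lt_card ((Finset.ssubset_iff_of_subset fun x hx => ?_).mpr ⟨u, hu, ?_⟩)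
  · by_contra hxf
    have hxu : u ≠ x := fun h => hxf (h ▸ hu)
    have hxv : v ≠ x := fun h => hxf (h ▸ hv)
    simp [coeff_monomial, hxu, hxv, notMem_support_iff.mp hxf] at hx
  · simp [coeff_monomial, huv]

end Monomials

section ComponentPrime

variable {K : Type*} [Field K] {V W : Type*}

open Classical in
/-- The connected component of the vertex `j` in `G - T`, with the value `none` if `j ∈ T`. -/
noncomputable def componentAfter (G : SimpleGraph W) (T : Finset W) (j : W) :
    Option (G.induce {v | v ∉ T}).ConnectedComponent :=
  if h : j ∉ T then some ((G.induce {v | v ∉ T}).connectedComponentMk ⟨j, h⟩) else none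

/-- The prime ideal `P_T(K_V, G)` of the generic `V × W` matrix whose zero locus consists of the
matrices with zero columns in `T` and rank at most one on each connected component of `G - T`. -/
noncomputable def componentPrime (K : Type*) [Field K] (V : Type*) (G : SimpleGraph W)
    (T : Finset W) : Ideal (MvPolynomial (V × W) K) :=
  RingHom.ker (blockMap K V T (componentAfter G T))

instance isPrime_componentPrime (G : SimpleGraph W) (T : Finset W) :
    (componentPrime K V G T).IsPrime :=
  RingHom.ker_isPrime _

variable {G : SimpleGraph W} {T : Finset W} {j l : W}

theorem componentAfter_eq_none : componentAfter G T j = none ↔ j ∈ T := by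
  simp [componentAfter]

theorem componentAfter_of_notMem (h : j ∉ T) :
    componentAfter G T j = some ((G.induce {v | v ∉ T}).connectedComponentMk ⟨j, h⟩) := by
  simp [componentAfter, h]

theorem componentAfter_eq_iff (hj : j ∉ T) (hl : l ∉ T) :
    componentAfter G T j = componentAfter G T l ↔
      (G.induce {v | v ∉ T}).Reachable ⟨j, hj⟩ ⟨l, hl⟩ := by
  simp [componentAfter, hj, hl]

theorem componentAfter_eq_of_adj (h : G.Adj j l) (hj : j ∉ T) (hl : l ∉ T) :
    componentAfter G T j = componentAfter G T l :=
  (componentAfter_eq_iff hj hl).mpr (Adj.reachable (by simpa using h))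

theorem pairBinomialEdgeIdeal_le_componentPrime (G₁ : SimpleGraph V) (G : SimpleGraph W)
    (T : Finset W) : pairBinomialEdgeIdeal K G₁ G ≤ componentPrime K V G T := by
  refine Ideal.span_le.mpr ?_
  rintro _ ⟨i, j, k, l, -, hkl, rfl⟩
  rw [SetLike.mem_coe, componentPrime, RingHom.mem_ker, map_sub, map_mul, map_mul]
  by_cases hk : k ∈ T
  · simp [blockMap_X_of_mem hk]
  by_cases hl : l ∈ T
  · simp [blockMap_X_of_mem hl]
  simp only [blockMap_X_of_notMem hk, blockMap_X_of_notMem hl, componentAfter_eq_of_adj hkl hk hl]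
  ring

/-- The class of the monomial with exponent `u` modulo `J_{K_V,G}`. -/
noncomputable def monomialClass (K : Type*) [Field K] (G : SimpleGraph W) (u : V × W →₀ ℕ) :
    MvPolynomial (V × W) K ⧸ pairBinomialEdgeIdeal K (⊤ : SimpleGraph V) G :=
  Ideal.Quotient.mk _ (monomial u 1)

theorem monomialClass_add (u v : V × W →₀ ℕ) :
    monomialClass K G (u + v) = monomialClass K G u * monomialClass K G v := by
  rw [monomialClass, monomialClass, monomialClass, ← map_mul, monomial_mul, mul_one]

theorem monomialClass_mul_eq_of_adj (h : G.Adj j l) (a b : V) :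
    monomialClass K G (.single (a, j) 1) * monomialClass K G (.single (b, l) 1) =
      monomialClass K G (.single (b, j) 1) * monomialClass K G (.single (a, l) 1) := by
  rcases eq_or_ne a b with rfl | hab
  · rfl
  · refine (map_mul _ _ _).symm.trans (.trans ?_ (map_mul _ _ _))
    rw [Ideal.Quotient.mk_eq_mk_iff_sub_mem, mul_comm (monomial (.single (b, j) 1) 1)]
    exact Ideal.subset_span ⟨a, b, j, l, hab, h, rfl⟩

/-- Along a path from `j` to `l` the entries `a` and `b` can be exchanged one edge at a time,
because `w` contains an entry of every column that is passed. -/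
theorem monomialClass_swap (hjl : componentAfter G T j = componentAfter G T l) (hj : j ∉ T)
    (w : V × W →₀ ℕ) (hw : ∀ k ∉ T, k ≠ j → k ≠ l → ∃ i, w (i, k) ≠ 0) (a b : V) :
    monomialClass K G w * (monomialClass K G (.single (a, j) 1) *
        monomialClass K G (.single (b, l) 1)) =
      monomialClass K G w * (monomialClass K G (.single (b, j) 1) *
        monomialClass K G (.single (a, l) 1)) := by
  classical
  have hl : l ∉ T := by rwa [← componentAfter_eq_none (G := G), ← hjl, componentAfter_eq_none]
  suffices H : ∀ x : {v | v ∉ T}, Relation.ReflTransGen (G.induce {v | v ∉ T}).Adj ⟨j, hj⟩ x →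
      ∀ w : V × W →₀ ℕ, (∀ k ∉ T, k ≠ j → k ≠ x.1 → ∃ i, w (i, k) ≠ 0) → ∀ a b : V,
      monomialClass K G w * (monomialClass K G (.single (a, j) 1) *
          monomialClass K G (.single (b, x.1) 1)) =
        monomialClass K G w * (monomialClass K G (.single (b, j) 1) *
          monomialClass K G (.single (a, x.1) 1)) from
    H ⟨l, hl⟩ ((reachable_iff_reflTransGen _ _).mp ((componentAfter_eq_iff hj hl).mp hjl)) w hw a b
  intro x hx
  induction hx with
  | refl =>
    intro w _ a b
    rw [mul_comm (monomialClass K G (.single (a, j) 1))]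
  | @tail k l _ hkl ih =>
    intro w hw a b
    have hkl : G.Adj k.1 l.1 := hkl
    rcases eq_or_ne k.1 j with hk | hk
    · rw [monomialClass_mul_eq_of_adj (hk ▸ hkl)]
    obtain ⟨i, hi⟩ := hw k.1 k.2 hk hkl.ne
    obtain ⟨w, rfl⟩ := exists_eq_add_single hi
    have hswap := ih (w + .single (i, l.1) 1) (fun c hc hcj hck => by
      rcases eq_or_ne c l.1 with rfl | hcl
      · exact ⟨i, by simp⟩
      · obtain ⟨d, hd⟩ := hw c hc hcj hcl
        exact ⟨d, by simpa [Finsupp.single_apply, hck.symm, hcl.symm] using hd⟩) a b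
    have hb := monomialClass_mul_eq_of_adj (K := K) hkl i b
    have ha := monomialClass_mul_eq_of_adj (K := K) hkl i a
    rw [monomialClass_add] at hswap ⊢
    linear_combination hswap +
      monomialClass K G w * monomialClass K G (.single (a, j) 1) * hb -
      monomialClass K G w * monomialClass K G (.single (b, j) 1) * ha

theorem exists_monomialClass_eq_add_single {u v w : V × W →₀ ℕ}
    (huv : blockDegree (componentAfter G T) u = blockDegree (componentAfter G T) v)
    (hcover : ∀ l ∉ T, blockDegree (componentAfter G T) (w + v) (.inr l) ≠ 0) {i : V}
    (hj : j ∉ T) (hu : u (i, j) ≠ 0) :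
    ∃ v', blockDegree (componentAfter G T) v =
        blockDegree (componentAfter G T) (v' + .single (i, j) 1) ∧
      monomialClass K G w * monomialClass K G v =
        monomialClass K G w * monomialClass K G (v' + .single (i, j) 1) := by
  classical
  by_cases hv : v (i, j) = 0
  swap
  · obtain ⟨v', rfl⟩ := exists_eq_add_single hv
    exact ⟨v', rfl, rfl⟩
  obtain ⟨l, hlj, hl⟩ := blockDegree_inl_ne_zero.mp
    (huv ▸ blockDegree_inl_ne_zero.mpr ⟨j, rfl, hu⟩)
  obtain ⟨a, ha⟩ := blockDegree_inr_ne_zero.mp (huv ▸ blockDegree_inr_ne_zero.mpr ⟨i, hu⟩)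
  have hjl : j ≠ l := fun h => hl (h ▸ hv)
  obtain ⟨v, rfl⟩ := exists_eq_add_single ha
  obtain ⟨v, rfl⟩ := exists_eq_add_single (u := v) (p := (i, l))
    (by simpa [Finsupp.single_apply, hjl] using hl)
  refine ⟨v + .single (a, l) 1, ?_, ?_⟩
  · simp only [map_add, blockDegree_single, hlj]
    abel
  · have hswap := monomialClass_swap (K := K) hlj.symm hj (w + v) (fun k hk hkj hkl => by
      obtain ⟨d, hd⟩ := blockDegree_inr_ne_zero.mp (hcover k hk)
      exact ⟨d, by simpa [Finsupp.single_apply, hkj.symm, hkl.symm] using hd⟩) a i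
    simp only [monomialClass_add] at hswap ⊢
    linear_combination hswap

theorem monomialClass_eq_of_blockDegree_eq {n : ℕ} {u v w : V × W →₀ ℕ} (hn : u.degree = n)
    (huv : blockDegree (componentAfter G T) u = blockDegree (componentAfter G T) v)
    (huT : ∀ p, u p ≠ 0 → p.2 ∉ T)
    (hcover : ∀ l ∉ T, blockDegree (componentAfter G T) (w + u) (.inr l) ≠ 0) :
    monomialClass K G w * monomialClass K G u = monomialClass K G w * monomialClass K G v := by
  induction n generalizing u v w with
  | zero =>
    obtain rfl : u = 0 := (Finsupp.degree_eq_zero_iff u).mp hn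
    obtain rfl : v = 0 := by
      ext ⟨i, j⟩
      by_contra hv
      refine blockDegree_inr_ne_zero (c := componentAfter G T).mpr ⟨i, hv⟩ ?_
      rw [← huv, map_zero, Finsupp.zero_apply]
    rfl
  | succ n ih =>
    obtain ⟨⟨i, j⟩, hij⟩ : ∃ p, u p ≠ 0 := by
      by_contra! h
      obtain rfl : u = 0 := Finsupp.ext h
      simp at hn
    obtain ⟨v', hv', hclass⟩ := exists_monomialClass_eq_add_single (K := K) huv
      (by simpa only [map_add, huv] using hcover) (huT _ hij) hij
    obtain ⟨u', rfl⟩ := exists_eq_add_single hij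
    rw [hclass, monomialClass_add, monomialClass_add, mul_comm (monomialClass K G u'),
      mul_comm (monomialClass K G v'), ← mul_assoc, ← mul_assoc, ← monomialClass_add]
    refine ih ?_ ?_ (fun p hp => huT p (by simp [hp])) fun l hl => ?_
    · simpa using hn
    · simpa only [map_add, add_left_inj] using huv.trans hv'
    · rw [add_assoc, add_comm (Finsupp.single _ _)]
      exact hcover l hl

theorem pairBinomialEdgeIdeal_top_eq_iInf [Finite W] (G : SimpleGraph W) :
    pairBinomialEdgeIdeal K (⊤ : SimpleGraph V) G = ⨅ T, componentPrime K V G T := by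
  classical
  have := Fintype.ofFinite W
  refine le_antisymm (le_iInf fun T => pairBinomialEdgeIdeal_le_componentPrime _ _ _) fun f hf => ?_
  rw [Ideal.mem_iInf] at hf
  induction hn : f.support.card using Nat.strong_induction_on generalizing f with
  | _ n ih =>
  obtain rfl | ⟨u, hu⟩ : f = 0 ∨ f.support.Nonempty := by
    simpa [Finset.nonempty_iff_ne_empty] using em (f = 0)
  · exact zero_mem _
  let T : Finset W := {j | ∀ i, u (i, j) = 0}
  have huT (p : V × W) (hp : u p ≠ 0) : p.2 ∉ T := fun h => hp ((Finset.mem_filter.mp h).2 p.1)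
  obtain ⟨v, hv, hvu, huv⟩ := exists_blockDegree_eq_of_mem_ker (hf T) hu huT
  have hclass := monomialClass_eq_of_blockDegree_eq (K := K) (w := 0) rfl huv.symm huT
    fun l hl => by simpa [T, blockDegree_inr_ne_zero] using hl
  have hmem : C (coeff u f) * (monomial u 1 - monomial v 1) ∈
      pairBinomialEdgeIdeal K (⊤ : SimpleGraph V) G := by
    refine Ideal.mul_mem_left _ _ ((Ideal.Quotient.mk_eq_mk_iff_sub_mem _ _).mp ?_)
    rw [← monomialClass_add, ← monomialClass_add, zero_add, zero_add] at hclass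
    exact hclass
  rw [← sub_add_cancel f (C (coeff u f) * (monomial u 1 - monomial v 1))]
  refine add_mem (ih _ (hn ▸ card_support_sub_lt hu hv hvu) _ (fun T => ?_) rfl) hmem
  exact sub_mem (hf T) (pairBinomialEdgeIdeal_le_componentPrime _ _ _ hmem)

end ComponentPrime

/-! ### Radical unmixed ideals and cut sets -/

section AssociatedPrimes

variable {R : Type*} [CommRing R] [IsNoetherianRing R] {I : Ideal R}

theorem minimalPrimes_subset_associatedPrimes (I : Ideal R) :
    I.minimalPrimes ⊆ associatedPrimes R (R ⧸ I) := by
  simpa only [Ideal.annihilator_quotient] using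
    Module.associatedPrimes.minimalPrimes_annihilator_subset_associatedPrimes R (R ⧸ I)

theorem associatedPrimes_quotient_of_isRadical (hI : I.IsRadical) :
    associatedPrimes R (R ⧸ I) = I.minimalPrimes := by
  classical
  refine subset_antisymm (fun p hp => ?_) (minimalPrimes_subset_associatedPrimes I)
  rw [AssociatedPrimes.mem_iff, isAssociatedPrime_iff] at hp
  obtain ⟨hp, x, hx⟩ := hp
  obtain ⟨f, rfl⟩ := Ideal.Quotient.mk_surjective x
  have hmem (r : R) : r ∈ p ↔ r * f ∈ I := by
    rw [hx, Submodule.mem_colon_singleton, Submodule.mem_bot, ← Ideal.Quotient.eq_zero_iff_mem,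
      map_mul]
    rfl
  have hfin := Ideal.finite_minimalPrimes_of_isNoetherianRing R I
  obtain ⟨q, hq, hqp⟩ : ∃ q ∈ {q ∈ hfin.toFinset | f ∉ q}, id q ≤ p := by
    refine (Ideal.IsPrime.inf_le' hp).mp fun r hr => (hmem r).mpr ?_
    rw [← hI.radical, ← Ideal.sInf_minimalPrimes, Submodule.mem_sInf]
    intro q hq
    by_cases hfq : f ∈ q
    · exact Ideal.mul_mem_left _ _ hfq
    · exact Ideal.mul_mem_right _ _ (Submodule.mem_finsetInf.mp hr q (by simp [hq, hfq]))
  obtain ⟨hq, hfq⟩ : q ∈ I.minimalPrimes ∧ f ∉ q := by simpa using hq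
  have hpq : p ≤ q := fun r hr =>
    (hq.1.1.mem_or_mem (hq.1.2 ((hmem r).mp hr))).resolve_right hfq
  rwa [hpq.antisymm hqp]

theorem isUnmixed_iff_of_isRadical (hI : I.IsRadical) :
    I.IsUnmixed ↔ ∀ p ∈ I.minimalPrimes, ∀ q ∈ I.minimalPrimes, p.height = q.height := by
  rw [Ideal.IsUnmixed, associatedPrimes_quotient_of_isRadical hI]

end AssociatedPrimes

section CutSets

variable {W W' : Type*} {G : SimpleGraph W} {T : Finset W} {i : W}

theorem apply_eq_of_reachable {α : Type*} {f : W → α} (hf : ∀ a b, G.Adj a b → f a = f b)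
    {a b : W} (h : G.Reachable a b) : f a = f b := by
  obtain ⟨p⟩ := h
  induction p with
  | nil => rfl
  | cons hab _ ih => exact (hf _ _ hab).trans ih

theorem numComponents_congr {G' : SimpleGraph W'} (e : G ≃g G') :
    G.numComponents = G'.numComponents :=
  Nat.card_congr e.connectedComponentEquiv

theorem numComponents_eq_one (h : G.Connected) : G.numComponents = 1 := by
  have := h.nonempty
  have := h.preconnected.subsingleton_connectedComponent
  exact Nat.card_of_subsingleton (G.connectedComponentMk (Classical.arbitrary W))

theorem numComponentsAfter_empty (G : SimpleGraph W) :
    G.numComponentsAfter ∅ = G.numComponents := by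
  have h : {v : W | v ∉ (∅ : Finset W)} = Set.univ := by simp
  rw [numComponentsAfter, h, numComponents_congr (induceUnivIso G)]

theorem numComponentsAfter_empty_of_connected (h : G.Connected) : G.numComponentsAfter ∅ = 1 := by
  rw [numComponentsAfter_empty, numComponents_eq_one h]

theorem card_image_componentAfter [Fintype W] [DecidableEq W]
    [DecidableEq (Option (G.induce {v | v ∉ T}).ConnectedComponent)] :
    (Tᶜ.image (componentAfter G T)).card = G.numComponentsAfter T := by
  have h : componentAfter G T '' {v | v ∉ T} = Set.range some := by
    ext k
    constructor
    · rintro ⟨j, hj, rfl⟩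
      exact ⟨_, (componentAfter_of_notMem hj).symm⟩
    · rintro ⟨k, rfl⟩
      obtain ⟨⟨j, hj⟩, rfl⟩ := Quot.exists_rep k
      exact ⟨j, hj, componentAfter_of_notMem hj⟩
  rw [← Set.ncard_coe_finset, Finset.coe_image, Finset.coe_compl,
    show (↑T : Set W)ᶜ = {v | v ∉ T} from rfl, h, ← Nat.card_coe_set_eq,
    Nat.card_range_of_injective (Option.some_injective _)]
  rfl

theorem numComponentsAfter_add_card_le [Fintype W] (G : SimpleGraph W) (T : Finset W) :
    G.numComponentsAfter T + T.card ≤ Fintype.card W := by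
  classical
  rw [← card_image_componentAfter, ← Finset.card_compl_add_card T]
  gcongr
  exact Finset.card_image_le

/-- Deleting the vertex `i` of `T` from the graph induced on `(V(G) \ T) ∪ {i}` amounts to deleting
`T` from `G`. -/
def induceInduceIso (G : SimpleGraph W) (hi : i ∈ T) :
    (G.induce {v | v ∉ T ∨ v = i}).induce {w | w ≠ ⟨i, Or.inr rfl⟩} ≃g G.induce {v | v ∉ T} where
  toFun x := ⟨x.1.1, x.1.2.resolve_right fun h => x.2 (Subtype.ext h)⟩
  invFun x := ⟨⟨x.1, Or.inl x.2⟩, fun h => x.2 (by rw [congrArg Subtype.val h]; exact hi)⟩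
  left_inv _ := rfl
  right_inv _ := rfl
  map_rel_iff' := Iff.rfl

/-- Putting `i` back does not connect different components of `G - T`: assign to `i` the common
component of its neighbours, and components stay constant along edges. -/
theorem componentAfter_eq_of_reachable
    (h : ∀ a ∉ T, ∀ b ∉ T, G.Adj i a → G.Adj i b → componentAfter G T a = componentAfter G T b)
    {s : Set W} (hs : ∀ v ∈ s, v ∉ T ∨ v = i) {x y : s} (hx : x.1 ∉ T) (hy : y.1 ∉ T)
    (hxy : (G.induce s).Reachable x y) :
    componentAfter G T x = componentAfter G T y := by
  classical
  obtain ⟨d, hd⟩ : ∃ d, ∀ a ∉ T, G.Adj i a → componentAfter G T a = d := by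
    by_cases hn : ∃ a ∉ T, G.Adj i a
    · obtain ⟨a, ha, hia⟩ := hn
      exact ⟨_, fun b hb hib => h b hb a ha hib hia⟩
    · exact ⟨none, fun a ha hia => (hn ⟨a, ha, hia⟩).elim⟩
  let g (z : W) := if z ∉ T then componentAfter G T z else d
  suffices g x = g y by simpa only [g, hx, hy, not_false_eq_true, if_true] using this
  refine apply_eq_of_reachable (f := fun z : s => g z) (fun z w hzw => ?_) hxy
  have hzw : G.Adj z.1 w.1 := hzw
  by_cases hz : z.1 ∈ T <;> by_cases hw : w.1 ∈ T
  · simp [g, hz, hw]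
  · obtain rfl := (hs _ z.2).resolve_left (not_not.mpr hz)
    simp [g, hz, hw, hd _ hw hzw]
  · obtain rfl := (hs _ w.2).resolve_left (not_not.mpr hw)
    simp [g, hz, hw, hd _ hz hzw.symm]
  · simp [g, hz, hw, componentAfter_eq_of_adj hzw hz hw]

theorem isCutPoint_induce_iff [Finite W] (hi : i ∈ T) :
    (G.induce {v | v ∉ T ∨ v = i}).IsCutPoint ⟨i, Or.inr rfl⟩ ↔
      ∃ a ∉ T, ∃ b ∉ T, G.Adj i a ∧ G.Adj i b ∧
        componentAfter G T a ≠ componentAfter G T b := by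
  have hle : {v | v ∉ T} ⊆ {v | v ∉ T ∨ v = i} := fun v hv => Or.inl hv
  let f : (G.induce {v | v ∉ T}).ConnectedComponent →
      (G.induce {v | v ∉ T ∨ v = i}).ConnectedComponent :=
    ConnectedComponent.map (induceHomOfLE G hle).toHom
  rw [IsCutPoint, numComponents_congr (induceInduceIso G hi), numComponents, numComponents]
  constructor
  · intro hlt
    by_contra! hno
    refine hlt.not_ge (Nat.card_le_card_of_injective f ?_)
    refine ConnectedComponent.ind₂ fun x y hxy => ?_
    have h := componentAfter_eq_of_reachable hno (fun _ => id) (x := ⟨x.1, hle x.2⟩)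
      (y := ⟨y.1, hle y.2⟩) x.2 y.2 (ConnectedComponent.exact hxy)
    exact ConnectedComponent.sound ((componentAfter_eq_iff x.2 y.2).mp h)
  · rintro ⟨a, ha, b, hb, hia, hib, hab⟩
    have hfi (c : W) (hc : c ∉ T) (hic : G.Adj i c) :
        f (connectedComponentMk _ ⟨c, hc⟩) = connectedComponentMk _ ⟨i, Or.inr rfl⟩ :=
      ConnectedComponent.sound (Adj.reachable hic.symm)
    have := Fintype.ofFinite (G.induce {v | v ∉ T}).ConnectedComponent
    have := Fintype.ofFinite (G.induce {v | v ∉ T ∨ v = i}).ConnectedComponent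
    rw [Nat.card_eq_fintype_card, Nat.card_eq_fintype_card]
    refine Fintype.card_lt_of_surjective_not_injective f ?_ fun hinj => ?_
    · refine ConnectedComponent.ind ?_
      rintro ⟨v, hv | rfl⟩
      · exact ⟨connectedComponentMk _ ⟨v, hv⟩, rfl⟩
      · exact ⟨_, hfi a ha hia⟩
    · exact hab ((componentAfter_eq_iff ha hb).mpr
        (ConnectedComponent.exact (hinj ((hfi a ha hia).trans (hfi b hb hib).symm))))

theorem mem_cutPointSets_iff [Finite W] :
    T ∈ G.cutPointSets ↔ ∀ i ∈ T, ∃ a ∉ T, ∃ b ∉ T, G.Adj i a ∧ G.Adj i b ∧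
      componentAfter G T a ≠ componentAfter G T b := by
  have h : T ∈ G.cutPointSets ↔ G.HasCutPointProperty T := by
    refine ⟨?_, Or.inr⟩
    rintro (rfl | h)
    · simp [HasCutPointProperty]
    · exact h
  rw [h]
  exact forall₂_congr fun i hi => isCutPoint_induce_iff hi

theorem empty_mem_cutPointSets (G : SimpleGraph W) : ∅ ∈ G.cutPointSets :=
  Or.inl rfl

theorem two_le_numComponentsAfter_iff [Finite W] : 2 ≤ G.numComponentsAfter T ↔
    ∃ a ∉ T, ∃ b ∉ T, componentAfter G T a ≠ componentAfter G T b := by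
  refine Finite.one_lt_card_iff_nontrivial.trans ⟨fun ⟨x, y, hxy⟩ => ?_, ?_⟩
  · obtain ⟨⟨a, ha⟩, rfl⟩ := x.exists_rep
    obtain ⟨⟨b, hb⟩, rfl⟩ := y.exists_rep
    exact ⟨a, ha, b, hb, fun h =>
      hxy (ConnectedComponent.sound ((componentAfter_eq_iff ha hb).mp h))⟩
  · rintro ⟨a, ha, b, hb, hab⟩
    exact ⟨connectedComponentMk _ ⟨a, ha⟩, connectedComponentMk _ ⟨b, hb⟩,
      fun h => hab ((componentAfter_eq_iff ha hb).mpr (ConnectedComponent.exact h))⟩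

theorem two_le_numComponentsAfter_compl_pair [Fintype W] [DecidableEq W] {u v : W} (huv : u ≠ v)
    (h : ¬ G.Adj u v) : 2 ≤ G.numComponentsAfter {u, v}ᶜ := by
  have hu : u ∉ ({u, v}ᶜ : Finset W) := by simp
  have hv : v ∉ ({u, v}ᶜ : Finset W) := by simp
  refine two_le_numComponentsAfter_iff.mpr ⟨u, hu, v, hv, fun he => huv ?_⟩
  refine apply_eq_of_reachable (f := Subtype.val) (fun a b hab => ?_)
    ((componentAfter_eq_iff hu hv).mp he)
  obtain ⟨a, ha⟩ := a
  obtain ⟨b, hb⟩ := b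
  have hab : G.Adj a b := hab
  obtain rfl | rfl : a = u ∨ a = v := by simpa [or_iff_not_imp_left] using ha
  · obtain rfl | rfl : b = a ∨ b = v := by simpa [or_iff_not_imp_left] using hb
    exacts [rfl, (h hab).elim]
  · obtain rfl | rfl : b = u ∨ b = a := by simpa [or_iff_not_imp_left] using hb
    exacts [(h hab.symm).elim, rfl]

theorem exists_cutPointSet_of_ne_top [Finite W] (h : G ≠ ⊤) :
    ∃ S ∈ G.cutPointSets, 2 ≤ G.numComponentsAfter S := by
  classical
  have := Fintype.ofFinite W
  obtain ⟨u, v, huv, hadj⟩ : ∃ u v, u ≠ v ∧ ¬ G.Adj u v := by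
    by_contra! hno
    exact h (eq_top_iff.mpr fun a b hab => hno a b hab)
  obtain ⟨S, hS⟩ := exists_minimal_of_wellFoundedLT (fun S => 2 ≤ G.numComponentsAfter S)
    ⟨_, two_le_numComponentsAfter_compl_pair huv hadj⟩
  refine ⟨S, Or.inr fun i hi => ?_, hS.prop⟩
  have hlt : G.numComponentsAfter (S.erase i) < 2 :=
    not_le.mp (hS.not_prop_of_lt (Finset.erase_ssubset hi))
  have hset : {v | v ∉ S ∨ v = i} = {v | v ∉ S.erase i} := by
    ext v
    simp only [Set.mem_ofPred_eq, Finset.mem_erase]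
    tauto
  rw [IsCutPoint, numComponents_congr (induceInduceIso G hi)]
  calc (G.induce {v | v ∉ S ∨ v = i}).numComponents
      = G.numComponentsAfter (S.erase i) := by rw [numComponentsAfter, hset]
    _ < 2 := hlt
    _ ≤ G.numComponentsAfter S := hS.prop

end CutSets

/-! ### Minimal primes -/

section MinimalPrimes

variable {K : Type*} [Field K] {V W κ κ' : Type*}

theorem ker_blockMap_le {T T' : Finset W} (hT : T ⊆ T') {c : W → κ} {c' : W → κ'}
    (hc : ∀ j ∉ T', ∀ l ∉ T', c j = c l → c' j = c' l) :
    RingHom.ker (blockMap K V T c) ≤ RingHom.ker (blockMap K V T' c') := by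
  classical
  let ψ : MvPolynomial ((V × κ) ⊕ W) K →ₐ[K] MvPolynomial ((V × κ') ⊕ W) K :=
    aeval (Sum.elim
      (fun q => if h : ∃ j ∉ T', c j = q.2 then X (.inl (q.1, c' h.choose)) else 0)
      (fun j => if j ∈ T' then 0 else X (.inr j)))
  have hψ : ψ.comp (blockMap K V T c) = blockMap K V T' c' := by
    ext ⟨i, j⟩ : 1
    by_cases hj : j ∈ T
    · simp [blockMap_X_of_mem hj, blockMap_X_of_mem (hT hj)]
    by_cases hj' : j ∈ T'
    · simp [blockMap_X_of_notMem hj, blockMap_X_of_mem hj', ψ, hj']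
    have h : ∃ l ∉ T', c l = c j := ⟨j, hj', rfl⟩
    have hcj : c' h.choose = c' j := hc _ h.choose_spec.1 _ hj' h.choose_spec.2
    simp only [AlgHom.comp_apply, blockMap_X_of_notMem hj, blockMap_X_of_notMem hj', ψ, map_mul,
      aeval_X, Sum.elim_inl, Sum.elim_inr, dif_pos h, hcj, if_neg hj']
  intro f hf
  rw [RingHom.mem_ker, ← hψ, AlgHom.comp_apply, RingHom.mem_ker.mp hf, map_zero]

variable {G₁ : SimpleGraph V} {G : SimpleGraph W} {S T : Finset W}

theorem X_mem_componentPrime {i : V} {j : W} : X (i, j) ∈ componentPrime K V G T ↔ j ∈ T := by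
  rw [componentPrime, RingHom.mem_ker]
  by_cases hj : j ∈ T
  · simp [hj, blockMap_X_of_mem hj]
  · simp [hj, blockMap_X_of_notMem hj]

theorem minor_mem_componentPrime_iff {j l : W} (hj : j ∉ T) (hl : l ∉ T) {a b : V} (hab : a ≠ b) :
    X (a, j) * X (b, l) - X (a, l) * X (b, j) ∈ componentPrime K V G T ↔
      componentAfter G T j = componentAfter G T l := by
  classical
  simp only [componentPrime, RingHom.mem_ker, map_sub, map_mul, blockMap_X_of_notMem hj,
    blockMap_X_of_notMem hl]
  refine ⟨fun h => ?_, fun h => by rw [h]; ring⟩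
  by_contra hne
  have heval := congrArg (eval (Sum.elim (fun q => if q = (a, componentAfter G T j) ∨
    q = (b, componentAfter G T l) then 1 else 0) (fun _ => 1) : _ → K)) h
  simp [hab, hne, hab.symm] at heval

theorem componentPrime_erase_le [DecidableEq W] {i : W}
    (h : ∀ a ∉ T, ∀ b ∉ T, G.Adj i a → G.Adj i b → componentAfter G T a = componentAfter G T b) :
    componentPrime K V G (T.erase i) ≤ componentPrime K V G T := by
  have hle (v : W) (hv : v ∉ T) : v ∉ T.erase i := mt Finset.mem_of_mem_erase hv
  refine ker_blockMap_le (T.erase_subset i) fun j hj l hl hjl => ?_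
  rw [componentAfter_eq_iff (hle _ hj) (hle _ hl)] at hjl
  refine componentAfter_eq_of_reachable h (fun v hv => ?_) hj hl hjl
  rw [Set.mem_ofPred_eq, Finset.mem_erase] at hv
  tauto

theorem eq_of_componentPrime_le [Finite W] [Nontrivial V] (hT : T ∈ G.cutPointSets)
    (h : componentPrime K V G S ≤ componentPrime K V G T) : S = T := by
  obtain ⟨a, b, hab⟩ := exists_pair_ne V
  have hST : S ⊆ T := fun j hj =>
    X_mem_componentPrime.mp (h (X_mem_componentPrime (i := a).mpr hj))
  refine hST.antisymm fun i hi => ?_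
  by_contra hiS
  obtain ⟨k, hk, l, hl, hik, hil, hkl⟩ := mem_cutPointSets_iff.mp hT i hi
  have hkS : k ∉ S := fun h => hk (hST h)
  have hlS : l ∉ S := fun h => hl (hST h)
  refine hkl ((minor_mem_componentPrime_iff (K := K) hk hl hab).mp (h ?_))
  rw [minor_mem_componentPrime_iff hkS hlS hab, ← componentAfter_eq_of_adj hik hiS hkS,
    componentAfter_eq_of_adj hil hiS hlS]

theorem exists_componentPrime_le [Finite W] {Q : Ideal (MvPolynomial (V × W) K)} [hQ : Q.IsPrime]
    (h : pairBinomialEdgeIdeal K ⊤ G ≤ Q) : ∃ T, componentPrime K V G T ≤ Q := by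
  have := Fintype.ofFinite W
  rw [pairBinomialEdgeIdeal_top_eq_iInf, ← Finset.inf_univ_eq_iInf] at h
  simpa using hQ.inf_le'.mp h

theorem exists_cutPointSet_of_mem_minimalPrimes [Finite W] [Nonempty V]
    {Q : Ideal (MvPolynomial (V × W) K)}
    (hQ : Q ∈ (pairBinomialEdgeIdeal K (⊤ : SimpleGraph V) G).minimalPrimes) :
    ∃ T ∈ G.cutPointSets, componentPrime K V G T = Q := by
  classical
  have := hQ.1.1
  obtain ⟨T, hTQ⟩ := exists_componentPrime_le hQ.1.2
  have hmin (S : Finset W) (hS : componentPrime K V G S ≤ Q) : Q ≤ componentPrime K V G S :=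
    hQ.2 ⟨inferInstance, pairBinomialEdgeIdeal_le_componentPrime _ _ _⟩ hS
  refine ⟨T, mem_cutPointSets_iff.mpr fun i hi => ?_, hTQ.antisymm (hmin T hTQ)⟩
  by_contra! hno
  have hle := hTQ.trans (hmin (T.erase i) ((componentPrime_erase_le hno).trans hTQ))
  have hX := hle (X_mem_componentPrime (i := Classical.arbitrary V).mpr hi)
  exact Finset.notMem_erase i T (X_mem_componentPrime.mp hX)

theorem mul_eq_mul_of_preconnected {F : Type*} [Field F] (hG₁ : G₁.Preconnected) {x y : V → F}
    (hy : ∀ a, y a ≠ 0) (h : ∀ a b, G₁.Adj a b → x a * y b = x b * y a) (a b : V) :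
    x a * y b = x b * y a := by
  rw [← div_eq_div_iff (hy a) (hy b)]
  exact apply_eq_of_reachable (f := fun a => x a / y a)
    (fun a b hab => (div_eq_div_iff (hy a) (hy b)).mpr (h a b hab)) (hG₁ a b)

theorem eq_zero_of_mul_ne_mul {F : Type*} [CommRing F] [IsDomain F] {x y z : V → F}
    (hxy : ∀ a b, x a * y b = x b * y a) (hxz : ∀ a b, x a * z b = x b * z a) {a b : V}
    (hyz : y a * z b ≠ y b * z a) (i : V) : x i = 0 := by
  have h : x i ^ 2 * (y a * z b - y b * z a) = 0 := by
    linear_combination x i * z b * hxy i a + y i * x a * hxz i b - x i * y b * hxz i a -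
      z i * x a * hxy i b
  exact pow_eq_zero_iff two_ne_zero |>.mp
    ((mul_eq_zero.mp h).resolve_right (sub_ne_zero.mpr hyz))

/-- At the generic point of a prime between `J_{G₁,G}` and `P_T`, the columns outside `T` have no
zero entry, so connectedness of `G₁` makes adjacent columns proportional as soon as one of them is
outside `T`; a column in `T` then vanishes because it is proportional to two non-proportional
columns. Hence the prime contains the ideal of the complete graph. -/
theorem pairBinomialEdgeIdeal_top_le [Finite W] [Nontrivial V] (hG₁ : G₁.Preconnected)
    (hT : T ∈ G.cutPointSets) {Q : Ideal (MvPolynomial (V × W) K)} [Q.IsPrime]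
    (hJQ : pairBinomialEdgeIdeal K G₁ G ≤ Q) (hQT : Q ≤ componentPrime K V G T) :
    pairBinomialEdgeIdeal K ⊤ G ≤ Q := by
  let y (j : W) (i : V) : Q.ResidueField := algebraMap (MvPolynomial (V × W) K) _ (X (i, j))
  have hminor (a b : V) (j l : W) : y j a * y l b = y j b * y l a ↔
      X (a, j) * X (b, l) - X (a, l) * X (b, j) ∈ Q := by
    rw [← Ideal.algebraMap_residueField_eq_zero, map_sub, map_mul, map_mul, sub_eq_zero,
      mul_comm (algebraMap _ _ (X (a, l)))]
  have hy (j : W) (hj : j ∉ T) (i : V) : y j i ≠ 0 := fun h =>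
    hj (X_mem_componentPrime.mp (hQT (Ideal.algebraMap_residueField_eq_zero.mp h)))
  have hedge (j l : W) (hjl : G.Adj j l) (hl : l ∉ T) (a b : V) :
      y j a * y l b = y j b * y l a :=
    mul_eq_mul_of_preconnected hG₁ (hy l hl) (fun a b hab => (hminor a b j l).mpr
      (hJQ (Ideal.subset_span ⟨a, b, j, l, hab, hjl, rfl⟩))) a b
  have hzero (j : W) (hj : j ∈ T) : ∀ i, y j i = 0 := by
    obtain ⟨k, hk, l, hl, hjk, hjl, hkl⟩ := mem_cutPointSets_iff.mp hT j hj
    obtain ⟨a, b, hab⟩ := exists_pair_ne V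
    refine eq_zero_of_mul_ne_mul (hedge j k hjk hk) (hedge j l hjl hl) (a := a) (b := b) fun h => ?_
    exact hkl ((minor_mem_componentPrime_iff (K := K) hk hl hab).mp (hQT ((hminor a b k l).mp h)))
  refine Ideal.span_le.mpr ?_
  rintro _ ⟨a, b, j, l, -, hjl, rfl⟩
  refine (hminor a b j l).mp ?_
  by_cases hl : l ∈ T
  · by_cases hj : j ∈ T
    · simp [hzero j hj]
    · linear_combination -hedge l j hjl.symm hj a b
  · exact hedge j l hjl hl a b

theorem componentPrime_mem_minimalPrimes [Finite W] [Nontrivial V] (hG₁ : G₁.Preconnected)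
    (hT : T ∈ G.cutPointSets) :
    componentPrime K V G T ∈ (pairBinomialEdgeIdeal K G₁ G).minimalPrimes := by
  refine ⟨⟨inferInstance, pairBinomialEdgeIdeal_le_componentPrime G₁ G T⟩, ?_⟩
  rintro Q ⟨hQ, hJQ⟩ hQT
  obtain ⟨S, hSQ⟩ := exists_componentPrime_le (pairBinomialEdgeIdeal_top_le hG₁ hT hJQ hQT)
  rwa [← eq_of_componentPrime_le hT (hSQ.trans hQT)]

theorem minimalPrimes_pairBinomialEdgeIdeal_top [Finite W] [Nontrivial V] (G : SimpleGraph W) :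
    (pairBinomialEdgeIdeal K (⊤ : SimpleGraph V) G).minimalPrimes =
      componentPrime K V G '' G.cutPointSets := by
  refine subset_antisymm (fun Q hQ => exists_cutPointSet_of_mem_minimalPrimes hQ) ?_
  rintro _ ⟨T, hT, rfl⟩
  exact componentPrime_mem_minimalPrimes connected_top.preconnected hT

end MinimalPrimes

/-! ### Unmixedness in terms of cut sets -/

section Unmixed

variable {K : Type*} [Field K] {V W : Type*} {G₁ : SimpleGraph V} {G : SimpleGraph W} {T : Finset W}

theorem height_componentPrime [Fintype V] [Nonempty V] [Fintype W] (G : SimpleGraph W)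
    (T : Finset W) : (componentPrime K V G T).height =
      (T.card + (Fintype.card V - 1) * (Fintype.card W - G.numComponentsAfter T) : ℕ) := by
  classical
  rw [componentPrime, height_ker_blockMap, card_image_componentAfter]

theorem height_componentPrime_eq_iff [Fintype V] [Nonempty V] [Finite W] (hG : G.Connected) :
    (componentPrime K V G T).height = (componentPrime K V G ∅).height ↔
      ((G.numComponentsAfter T : ℤ) - 1) * ((Fintype.card V : ℤ) - 1) = T.card := by
  cases nonempty_fintype W
  have := hG.nonempty
  have hV : 1 ≤ Fintype.card V := Fintype.card_pos
  have hW : 1 ≤ Fintype.card W := Fintype.card_pos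
  have hT : G.numComponentsAfter T ≤ Fintype.card W :=
    (Nat.le_add_right _ _).trans (numComponentsAfter_add_card_le G T)
  rw [height_componentPrime, height_componentPrime, Nat.cast_inj,
    numComponentsAfter_empty_of_connected hG, Finset.card_empty]
  zify [hV, hW, hT]
  constructor <;> intro h <;> linear_combination -h

theorem numComponentsAfter_sub_one_mul_eq_card [Fintype V] [Nontrivial V] [Finite W]
    (hG₁ : G₁.Connected) (hG : G.Connected)
    (h : ∀ p ∈ (pairBinomialEdgeIdeal K G₁ G).minimalPrimes,
      ∀ q ∈ (pairBinomialEdgeIdeal K G₁ G).minimalPrimes, p.height = q.height)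
    (hT : T ∈ G.cutPointSets) :
    ((G.numComponentsAfter T : ℤ) - 1) * ((Fintype.card V : ℤ) - 1) = T.card :=
  (height_componentPrime_eq_iff (K := K) hG).mp
    (h _ (componentPrime_mem_minimalPrimes hG₁.preconnected hT) _
      (componentPrime_mem_minimalPrimes hG₁.preconnected (empty_mem_cutPointSets G)))

theorem isRadical_pairBinomialEdgeIdeal_top [Finite W] (G : SimpleGraph W) :
    (pairBinomialEdgeIdeal K (⊤ : SimpleGraph V) G).IsRadical := by
  rw [pairBinomialEdgeIdeal_top_eq_iInf]
  exact Ideal.isRadical_iInf _ fun T => Ideal.IsPrime.isRadical inferInstance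

theorem isUnmixed_pairBinomialEdgeIdeal_top_iff [Fintype V] [Nontrivial V] [Finite W]
    (hG : G.Connected) :
    (pairBinomialEdgeIdeal K (⊤ : SimpleGraph V) G).IsUnmixed ↔ ∀ T ∈ G.cutPointSets,
      ((G.numComponentsAfter T : ℤ) - 1) * ((Fintype.card V : ℤ) - 1) = T.card := by
  rw [isUnmixed_iff_of_isRadical (isRadical_pairBinomialEdgeIdeal_top G)]
  refine ⟨fun h T hT => numComponentsAfter_sub_one_mul_eq_card connected_top hG h hT, fun h => ?_⟩
  rw [minimalPrimes_pairBinomialEdgeIdeal_top]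
  rintro _ ⟨S, hS, rfl⟩ _ ⟨T, hT, rfl⟩
  rw [(height_componentPrime_eq_iff hG).mpr (h S hS),
    (height_componentPrime_eq_iff hG).mpr (h T hT)]

theorem pairBinomialEdgeIdeal_le_comap_swap (G₁ : SimpleGraph V) (G : SimpleGraph W) :
    pairBinomialEdgeIdeal K G₁ G ≤ (pairBinomialEdgeIdeal K G G₁).comap
      (renameEquiv K (Equiv.prodComm V W)).toRingEquiv := by
  rw [pairBinomialEdgeIdeal, Ideal.span_le]
  rintro _ ⟨i, j, k, l, hij, hkl, rfl⟩
  refine Ideal.subset_span ⟨k, l, i, j, hkl, hij, ?_⟩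
  simp [mul_comm]

theorem comap_swap_pairBinomialEdgeIdeal (G₁ : SimpleGraph V) (G : SimpleGraph W) :
    (pairBinomialEdgeIdeal K G₁ G).comap
      (renameEquiv K (Equiv.prodComm W V)).toRingEquiv = pairBinomialEdgeIdeal K G G₁ := by
  refine le_antisymm (fun f hf => ?_) (pairBinomialEdgeIdeal_le_comap_swap G G₁)
  have h := pairBinomialEdgeIdeal_le_comap_swap G₁ G hf
  rw [Ideal.mem_comap] at h
  convert h
  exact ((renameEquiv K (Equiv.prodComm W V)).symm_apply_apply f).symm

theorem eq_top_of_isUnmixed [Fintype V] [Nontrivial V] [Fintype W] (hG₁ : G₁.Connected)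
    (hG : G.Connected) (hcard : Fintype.card V ≤ Fintype.card W)
    (h : (pairBinomialEdgeIdeal K G₁ G).IsUnmixed) : G₁ = ⊤ := by
  by_contra hne
  obtain ⟨S, hS, hS2⟩ := exists_cutPointSet_of_ne_top hne
  have : Nontrivial W := Fintype.one_lt_card_iff_nontrivial.mp
    (Fintype.one_lt_card.trans_le hcard)
  let e := (renameEquiv K (Equiv.prodComm W V)).toRingEquiv
  have hmin : (pairBinomialEdgeIdeal K G G₁).minimalPrimes =
      Ideal.comap e '' (pairBinomialEdgeIdeal K G₁ G).minimalPrimes := by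
    rw [← comap_swap_pairBinomialEdgeIdeal]
    exact Ideal.comap_minimalPrimes_eq_of_surjective (f := e.toRingHom) e.surjective _
  have hS' := numComponentsAfter_sub_one_mul_eq_card (K := K) hG hG₁ (by
    rw [hmin]
    rintro _ ⟨p, hp, rfl⟩ _ ⟨q, hq, rfl⟩
    rw [RingEquiv.height_comap, RingEquiv.height_comap]
    exact h p (minimalPrimes_subset_associatedPrimes _ hp) q
      (minimalPrimes_subset_associatedPrimes _ hq)) hS
  have hcardW : (Fintype.card W : ℤ) - 1 ≤ S.card := by
    rw [← hS']
    exact le_mul_of_one_le_left (by have := Fintype.card_pos (α := W); omega) (by omega)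
  have hV := numComponentsAfter_add_card_le G₁ S
  omega

end Unmixed

/-! ### Cut sets of joins and disjoint unions -/

section Embeddings

variable {W W' : Type*} {G : SimpleGraph W} {G' : SimpleGraph W'} {S : Finset W} {T : Finset W'}

theorem two_le_numComponentsAfter_iff_ne_empty [Finite W] (hG : G.Connected)
    (hS : S ∈ G.cutPointSets) : 2 ≤ G.numComponentsAfter S ↔ S ≠ ∅ := by
  constructor
  · rintro h rfl
    rw [numComponentsAfter_empty_of_connected hG] at h
    omega
  · intro h
    obtain ⟨i, hi⟩ := Finset.nonempty_iff_ne_empty.mpr h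
    obtain ⟨a, ha, b, hb, -, -, hab⟩ := mem_cutPointSets_iff.mp hS i hi
    exact two_le_numComponentsAfter_iff.mpr ⟨a, ha, b, hb, hab⟩

theorem numComponentsAfter_pos [Finite W] (hG : G.Connected) (hS : S ∈ G.cutPointSets) :
    0 < G.numComponentsAfter S := by
  rcases eq_or_ne S ∅ with rfl | hne
  · rw [numComponentsAfter_empty_of_connected hG]
    exact one_pos
  · exact two_pos.trans_le ((two_le_numComponentsAfter_iff_ne_empty hG hS).mpr hne)

/-- An embedding whose image of the complement of `S` is the complement of `T` identifies the graphs
`G - S` and `G' - T`. -/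
noncomputable def induceIsoOfEmbedding (f : G ↪g G') (hT : ∀ x, x ∉ T ↔ ∃ a ∉ S, f a = x) :
    G.induce {v | v ∉ S} ≃g G'.induce {v | v ∉ T} :=
  RelIso.ofSurjective
    { toFun := fun a => ⟨f a, (hT _).mpr ⟨a, a.2, rfl⟩⟩
      inj' := fun a b h => Subtype.ext (f.injective (congrArg Subtype.val h))
      map_rel_iff' := f.map_rel_iff }
    fun ⟨x, hx⟩ => by
      obtain ⟨a, ha, rfl⟩ := (hT x).mp hx
      exact ⟨⟨a, ha⟩, rfl⟩

theorem numComponentsAfter_eq_of_embedding (f : G ↪g G') (hT : ∀ x, x ∉ T ↔ ∃ a ∉ S, f a = x) :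
    G'.numComponentsAfter T = G.numComponentsAfter S :=
  (numComponents_congr (induceIsoOfEmbedding f hT)).symm

theorem componentAfter_eq_iff_of_embedding (f : G ↪g G') (hT : ∀ x, x ∉ T ↔ ∃ a ∉ S, f a = x)
    {a b : W} (ha : a ∉ S) (hb : b ∉ S) :
    componentAfter G' T (f a) = componentAfter G' T (f b) ↔
      componentAfter G S a = componentAfter G S b := by
  rw [componentAfter_eq_iff ((hT _).mpr ⟨a, ha, rfl⟩) ((hT _).mpr ⟨b, hb, rfl⟩),
    componentAfter_eq_iff ha hb]
  exact (induceIsoOfEmbedding f hT).reachable_iff (u := ⟨a, ha⟩) (v := ⟨b, hb⟩)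

theorem mem_cutPointSets_iff_of_embedding [Finite W] [Finite W'] (f : G ↪g G')
    (hT : ∀ x, x ∉ T ↔ ∃ a ∉ S, f a = x) (hadj : ∀ x ∉ Set.range f, ∀ a, G'.Adj x (f a))
    (hf : ∃ x, x ∉ Set.range f) :
    T ∈ G'.cutPointSets ↔ S ∈ G.cutPointSets ∧ 2 ≤ G.numComponentsAfter S := by
  have hfT (a : W) : f a ∈ T ↔ a ∈ S := by
    rw [← not_iff_not, hT]
    simp [f.injective.eq_iff]
  have hexists (x : W') : (∃ y ∉ T, ∃ z ∉ T, G'.Adj x y ∧ G'.Adj x z ∧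
      componentAfter G' T y ≠ componentAfter G' T z) ↔
      ∃ a ∉ S, ∃ b ∉ S, G'.Adj x (f a) ∧ G'.Adj x (f b) ∧
        componentAfter G S a ≠ componentAfter G S b := by
    constructor
    · rintro ⟨y, hy, z, hz, hxy, hxz, hyz⟩
      obtain ⟨a, ha, rfl⟩ := (hT y).mp hy
      obtain ⟨b, hb, rfl⟩ := (hT z).mp hz
      exact ⟨a, ha, b, hb, hxy, hxz, (componentAfter_eq_iff_of_embedding f hT ha hb).not.mp hyz⟩
    · rintro ⟨a, ha, b, hb, hxa, hxb, hab⟩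
      exact ⟨f a, (hfT a).not.mpr ha, f b, (hfT b).not.mpr hb, hxa, hxb,
        (componentAfter_eq_iff_of_embedding f hT ha hb).not.mpr hab⟩
  simp only [mem_cutPointSets_iff, two_le_numComponentsAfter_iff, hexists]
  constructor
  · intro h
    refine ⟨fun i hi => by simpa only [f.map_adj_iff] using h (f i) ((hfT i).mpr hi), ?_⟩
    obtain ⟨x, hx⟩ := hf
    obtain ⟨a, ha, b, hb, -, -, hab⟩ := h x (by
      by_contra hxT
      obtain ⟨a, -, rfl⟩ := (hT x).mp hxT
      exact hx ⟨a, rfl⟩)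
    exact ⟨a, ha, b, hb, hab⟩
  · rintro ⟨h, a, ha, b, hb, hab⟩ x hx
    by_cases hxf : x ∈ Set.range f
    · obtain ⟨i, rfl⟩ := hxf
      simpa only [f.map_adj_iff] using h i ((hfT i).mp hx)
    · exact ⟨a, ha, b, hb, hadj x hxf a, hadj x hxf b, hab⟩

end Embeddings

section Join

variable {U W : Type*} {G : SimpleGraph U} {G' : SimpleGraph W}

theorem joinGraph_adj_inl_inl {a b : U} : (G.joinGraph G').Adj (.inl a) (.inl b) ↔ G.Adj a b := by
  simp [joinGraph]

theorem joinGraph_adj_inr_inr {a b : W} : (G.joinGraph G').Adj (.inr a) (.inr b) ↔ G'.Adj a b := by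
  simp [joinGraph]

theorem joinGraph_adj_inl_inr (a : U) (b : W) : (G.joinGraph G').Adj (.inl a) (.inr b) := by
  simp [joinGraph]

theorem joinGraph_connected [Nonempty U] [Nonempty W] (G : SimpleGraph U) (G' : SimpleGraph W) :
    (G.joinGraph G').Connected := by
  obtain ⟨u⟩ := ‹Nonempty U›
  obtain ⟨w⟩ := ‹Nonempty W›
  refine connected_iff_exists_forall_reachable _ |>.mpr ⟨.inl u, ?_⟩
  rintro (a | b)
  · exact (joinGraph_adj_inl_inr u w).reachable.trans (joinGraph_adj_inl_inr a w).symm.reachable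
  · exact (joinGraph_adj_inl_inr u b).reachable

/-- If a vertex survives on each side, the two of them are adjacent to every other survivor up to
one step, so that the join stays connected. -/
theorem componentAfter_joinGraph_eq {T : Finset (U ⊕ W)} {u : U} {w : W} (hu : .inl u ∉ T)
    (hw : .inr w ∉ T) {x : U ⊕ W} (hx : x ∉ T) :
    componentAfter (G.joinGraph G') T x = componentAfter (G.joinGraph G') T (.inl u) := by
  rcases x with a | b
  · exact (componentAfter_eq_of_adj (joinGraph_adj_inl_inr a w) hx hw).trans
      (componentAfter_eq_of_adj (joinGraph_adj_inl_inr u w) hu hw).symm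
  · exact (componentAfter_eq_of_adj (joinGraph_adj_inl_inr u b) hu hx).symm

theorem inl_mem_or_inr_mem_of_mem_cutPointSets [Finite U] [Finite W] {T : Finset (U ⊕ W)}
    (hT : T ∈ (G.joinGraph G').cutPointSets) (hne : T ≠ ∅) :
    (∀ u, .inl u ∈ T) ∨ ∀ w, .inr w ∈ T := by
  by_contra! h
  obtain ⟨⟨u, hu⟩, ⟨w, hw⟩⟩ := h
  obtain ⟨i, hi⟩ := Finset.nonempty_iff_ne_empty.mpr hne
  obtain ⟨a, ha, b, hb, -, -, hab⟩ := mem_cutPointSets_iff.mp hT i hi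
  exact hab ((componentAfter_joinGraph_eq hu hw ha).trans
    (componentAfter_joinGraph_eq hu hw hb).symm)

/-- The inclusion of the left-hand graph into the join. -/
def joinGraphInl (G : SimpleGraph U) (G' : SimpleGraph W) : G ↪g G.joinGraph G' where
  toEmbedding := .inl
  map_rel_iff' := joinGraph_adj_inl_inl

/-- The inclusion of the right-hand graph into the join. -/
def joinGraphInr (G : SimpleGraph U) (G' : SimpleGraph W) : G' ↪g G.joinGraph G' where
  toEmbedding := .inr
  map_rel_iff' := joinGraph_adj_inr_inr

theorem notMem_disjSum_univ_iff [Fintype W] {S : Finset U} (x : U ⊕ W) :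
    x ∉ S.disjSum Finset.univ ↔ ∃ a ∉ S, joinGraphInl G G' a = x := by
  change _ ↔ ∃ a ∉ S, Sum.inl a = x
  rcases x with u | w <;> simp

theorem notMem_univ_disjSum_iff [Fintype U] {S : Finset W} (x : U ⊕ W) :
    x ∉ Finset.univ.disjSum S ↔ ∃ a ∉ S, joinGraphInr G G' a = x := by
  change _ ↔ ∃ a ∉ S, Sum.inr a = x
  rcases x with u | w <;> simp

theorem disjSum_univ_mem_cutPointSets_iff [Finite U] [Fintype W] [Nonempty W] {S : Finset U} :
    S.disjSum Finset.univ ∈ (G.joinGraph G').cutPointSets ↔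
      S ∈ G.cutPointSets ∧ 2 ≤ G.numComponentsAfter S := by
  refine mem_cutPointSets_iff_of_embedding (joinGraphInl G G') notMem_disjSum_univ_iff ?_
    ⟨.inr (Classical.arbitrary W), fun ⟨_, h⟩ => Sum.inl_ne_inr h⟩
  rintro (u | w) hx a
  · exact (hx ⟨u, rfl⟩).elim
  · exact (joinGraph_adj_inl_inr a w).symm

theorem univ_disjSum_mem_cutPointSets_iff [Fintype U] [Finite W] [Nonempty U] {S : Finset W} :
    Finset.univ.disjSum S ∈ (G.joinGraph G').cutPointSets ↔
      S ∈ G'.cutPointSets ∧ 2 ≤ G'.numComponentsAfter S := by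
  refine mem_cutPointSets_iff_of_embedding (joinGraphInr G G') notMem_univ_disjSum_iff ?_
    ⟨.inl (Classical.arbitrary U), fun ⟨_, h⟩ => Sum.inr_ne_inl h⟩
  rintro (u | w) hx a
  · exact joinGraph_adj_inl_inr u a
  · exact (hx ⟨w, rfl⟩).elim

variable [Fintype U] [Nonempty U] [Fintype W] [Nonempty W]

theorem mem_cutPointSets_joinGraph_iff {T : Finset (U ⊕ W)} :
    T ∈ (G.joinGraph G').cutPointSets ↔ T = ∅ ∨
      (∃ S ∈ G.cutPointSets, 2 ≤ G.numComponentsAfter S ∧ S.disjSum Finset.univ = T) ∨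
      ∃ S ∈ G'.cutPointSets, 2 ≤ G'.numComponentsAfter S ∧ Finset.univ.disjSum S = T := by
  constructor
  · refine fun hT => or_iff_not_imp_left.mpr fun hne => ?_
    have hsum := T.toLeft_disjSum_toRight
    rcases inl_mem_or_inr_mem_of_mem_cutPointSets hT hne with h | h
    · rw [Finset.eq_univ_of_forall fun u => Finset.mem_toLeft.mpr (h u)] at hsum
      obtain ⟨h1, h2⟩ := univ_disjSum_mem_cutPointSets_iff.mp (hsum.symm ▸ hT)
      exact Or.inr ⟨_, h1, h2, hsum⟩
    · rw [Finset.eq_univ_of_forall fun w => Finset.mem_toRight.mpr (h w)] at hsum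
      obtain ⟨h1, h2⟩ := disjSum_univ_mem_cutPointSets_iff.mp (hsum.symm ▸ hT)
      exact Or.inl ⟨_, h1, h2, hsum⟩
  · rintro (rfl | ⟨S, hS, h2, rfl⟩ | ⟨S, hS, h2, rfl⟩)
    · exact empty_mem_cutPointSets _
    · exact disjSum_univ_mem_cutPointSets_iff.mpr ⟨hS, h2⟩
    · exact univ_disjSum_mem_cutPointSets_iff.mpr ⟨hS, h2⟩

theorem forall_cutPointSets_joinGraph_iff (m : ℤ) :
    (∀ T ∈ (G.joinGraph G').cutPointSets,
      (((G.joinGraph G').numComponentsAfter T : ℤ) - 1) * m = T.card) ↔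
    (∀ S ∈ G.cutPointSets, 2 ≤ G.numComponentsAfter S →
      ((G.numComponentsAfter S : ℤ) - 1) * m = S.card + Fintype.card W) ∧
    ∀ S ∈ G'.cutPointSets, 2 ≤ G'.numComponentsAfter S →
      ((G'.numComponentsAfter S : ℤ) - 1) * m = Fintype.card U + S.card := by
  have hl (S : Finset U) := numComponentsAfter_eq_of_embedding (joinGraphInl G G')
    (notMem_disjSum_univ_iff (S := S))
  have hr (S : Finset W) := numComponentsAfter_eq_of_embedding (joinGraphInr G G')
    (notMem_univ_disjSum_iff (S := S))
  constructor
  · intro h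
    refine ⟨fun S hS h2 => ?_, fun S hS h2 => ?_⟩
    · simpa [hl] using h _ (disjSum_univ_mem_cutPointSets_iff.mpr ⟨hS, h2⟩)
    · simpa [hr] using h _ (univ_disjSum_mem_cutPointSets_iff.mpr ⟨hS, h2⟩)
  · rintro ⟨hG, hG'⟩ T hT
    rcases mem_cutPointSets_joinGraph_iff.mp hT with rfl | ⟨S, hS, h2, rfl⟩ | ⟨S, hS, h2, rfl⟩
    · simp [numComponentsAfter_empty_of_connected (joinGraph_connected G G')]
    · simpa [hl] using hG S hS h2
    · simpa [hr] using hG' S hS h2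

end Join

section Sigma

variable {ι : Type*} {V : ι → Type*} {H : ∀ i, SimpleGraph (V i)} {F : ∀ i, Finset (V i)}

theorem sigmaGraph_adj {x y : Σ i, V i} :
    (sigmaGraph H).Adj x y ↔ ∃ i a b, (H i).Adj a b ∧ ⟨i, a⟩ = x ∧ ⟨i, b⟩ = y := by
  simp [sigmaGraph, iSup_adj, map_adj]

theorem sigmaGraph_adj_mk {i : ι} {a b : V i} :
    (sigmaGraph H).Adj ⟨i, a⟩ ⟨i, b⟩ ↔ (H i).Adj a b := by
  rw [sigmaGraph_adj]
  constructor
  · rintro ⟨_, _, _, h, ⟨⟩, ⟨⟩⟩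
    exact h
  · exact fun h => ⟨i, a, b, h, rfl, rfl⟩

theorem sigmaGraph_adj_mk_left {i : ι} {a : V i} {x : Σ i, V i} :
    (sigmaGraph H).Adj ⟨i, a⟩ x ↔ ∃ b, (H i).Adj a b ∧ ⟨i, b⟩ = x := by
  rw [sigmaGraph_adj]
  constructor
  · rintro ⟨_, _, b, h, ⟨⟩, rfl⟩
    exact ⟨b, h, rfl⟩
  · rintro ⟨b, h, rfl⟩
    exact ⟨i, a, b, h, rfl, rfl⟩

theorem sigmaGraph_reachable_iff {x y : Σ i, V i} :
    (sigmaGraph H).Reachable x y ↔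
      (⟨x.1, (H x.1).connectedComponentMk x.2⟩ : Σ i, (H i).ConnectedComponent) =
        ⟨y.1, (H y.1).connectedComponentMk y.2⟩ := by
  constructor
  · refine apply_eq_of_reachable
      (f := fun x : Σ i, V i =>
        (⟨x.1, (H x.1).connectedComponentMk x.2⟩ : Σ i, (H i).ConnectedComponent)) ?_
    rintro ⟨i, a⟩ y hay
    obtain ⟨b, hab, rfl⟩ := sigmaGraph_adj_mk_left.mp hay
    exact congrArg (Sigma.mk i) (ConnectedComponent.sound hab.reachable)
  · obtain ⟨i, a⟩ := x
    obtain ⟨j, b⟩ := y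
    intro h
    obtain ⟨rfl, h⟩ := Sigma.mk.inj h
    exact (ConnectedComponent.exact (eq_of_heq h)).map
      (⟨Sigma.mk i, fun h => sigmaGraph_adj_mk.mpr h⟩ : H i →g sigmaGraph H)

theorem numComponents_sigmaGraph [Fintype ι] [∀ i, Finite (V i)] :
    (sigmaGraph H).numComponents = ∑ i, (H i).numComponents := by
  have e : (sigmaGraph H).ConnectedComponent ≃ Σ i, (H i).ConnectedComponent := by
    refine Equiv.ofBijective (Quot.lift (fun x => ⟨x.1, (H x.1).connectedComponentMk x.2⟩)
      fun _ _ h => sigmaGraph_reachable_iff.mp h) ⟨?_, ?_⟩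
    · exact ConnectedComponent.ind₂ fun x y h =>
        ConnectedComponent.sound (sigmaGraph_reachable_iff.mpr h)
    · rintro ⟨i, c⟩
      obtain ⟨a, rfl⟩ := c.exists_rep
      exact ⟨connectedComponentMk _ ⟨i, a⟩, rfl⟩
  rw [numComponents, Nat.card_congr e, Nat.card_sigma]
  rfl

variable [Fintype ι]

/-- Deleting vertices commutes with disjoint unions. -/
def sigmaGraphInduceIso (H : ∀ i, SimpleGraph (V i)) (F : ∀ i, Finset (V i)) :
    sigmaGraph (fun i => (H i).induce {v | v ∉ F i}) ≃g
      (sigmaGraph H).induce {v | v ∉ Finset.univ.sigma F} where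
  toFun x := ⟨⟨x.1, x.2.1⟩, by simpa [-Subtype.coe_prop] using x.2.2⟩
  invFun x := ⟨x.1.1, x.1.2, by simpa [-Subtype.coe_prop] using x.2⟩
  left_inv _ := rfl
  right_inv _ := rfl
  map_rel_iff' {x y} := by
    obtain ⟨i, a⟩ := x
    obtain ⟨j, b⟩ := y
    change (sigmaGraph H).Adj ⟨i, a⟩ ⟨j, b⟩ ↔ _
    rw [sigmaGraph_adj_mk_left, sigmaGraph_adj_mk_left]
    constructor
    · rintro ⟨_, h, ⟨⟩⟩
      exact ⟨_, h, rfl⟩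
    · rintro ⟨_, h, ⟨⟩⟩
      exact ⟨_, h, rfl⟩

theorem numComponentsAfter_sigmaGraph [∀ i, Finite (V i)] :
    (sigmaGraph H).numComponentsAfter (Finset.univ.sigma F) =
      ∑ i, (H i).numComponentsAfter (F i) := by
  rw [numComponentsAfter, ← numComponents_congr (sigmaGraphInduceIso H F), numComponents_sigmaGraph]
  rfl

theorem numComponentsAfter_sigmaGraph_sub_one_mul [∀ i, Finite (V i)] (m : ℤ) :
    (((sigmaGraph H).numComponentsAfter (Finset.univ.sigma F) : ℤ) - 1) * m =
      ∑ i, (((H i).numComponentsAfter (F i) : ℤ) - 1) * m + ((Fintype.card ι : ℤ) - 1) * m := by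
  rw [numComponentsAfter_sigmaGraph, ← Finset.sum_mul, Finset.sum_sub_distrib, Finset.sum_const,
    Finset.card_univ, nsmul_one]
  push_cast
  ring

theorem componentAfter_sigmaGraph_eq_iff {i : ι} {a b : V i} (ha : a ∉ F i) (hb : b ∉ F i) :
    componentAfter (sigmaGraph H) (Finset.univ.sigma F) ⟨i, a⟩ =
      componentAfter (sigmaGraph H) (Finset.univ.sigma F) ⟨i, b⟩ ↔
      componentAfter (H i) (F i) a = componentAfter (H i) (F i) b := by
  rw [componentAfter_eq_iff (by simpa using ha) (by simpa using hb), componentAfter_eq_iff ha hb]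
  refine ((sigmaGraphInduceIso H F).reachable_iff (u := ⟨i, ⟨a, ha⟩⟩)
    (v := ⟨i, ⟨b, hb⟩⟩)).trans (sigmaGraph_reachable_iff.trans ?_)
  rw [← ConnectedComponent.eq]
  exact sigma_mk_injective.eq_iff

theorem sigma_mem_cutPointSets_iff [∀ i, Finite (V i)] :
    Finset.univ.sigma F ∈ (sigmaGraph H).cutPointSets ↔ ∀ i, F i ∈ (H i).cutPointSets := by
  simp only [mem_cutPointSets_iff]
  constructor
  · intro h i v hv
    obtain ⟨x, hx, y, hy, hvx, hvy, hxy⟩ := h ⟨i, v⟩ (by simpa using hv)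
    obtain ⟨a, hva, rfl⟩ := sigmaGraph_adj_mk_left.mp hvx
    obtain ⟨b, hvb, rfl⟩ := sigmaGraph_adj_mk_left.mp hvy
    have ha : a ∉ F i := by simpa using hx
    have hb : b ∉ F i := by simpa using hy
    exact ⟨a, ha, b, hb, hva, hvb, (componentAfter_sigmaGraph_eq_iff ha hb).not.mp hxy⟩
  · rintro h ⟨i, v⟩ hv
    obtain ⟨a, ha, b, hb, hva, hvb, hab⟩ := h i v (by simpa using hv)
    exact ⟨⟨i, a⟩, by simpa using ha, ⟨i, b⟩, by simpa using hb, sigmaGraph_adj_mk.mpr hva,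
      sigmaGraph_adj_mk.mpr hvb, (componentAfter_sigmaGraph_eq_iff ha hb).not.mpr hab⟩

theorem exists_sigma_eq [∀ i, Finite (V i)] (T : Finset (Σ i, V i)) :
    ∃ F : ∀ i, Finset (V i), Finset.univ.sigma F = T := by
  classical
  exact ⟨_, T.sigma_preimage_mk_of_subset (Finset.subset_univ _)⟩

theorem forall_cutPointSets_sigmaGraph_iff [∀ i, Finite (V i)] (hH : ∀ i, (H i).Connected)
    (u m : ℤ) :
    (∀ T ∈ (sigmaGraph H).cutPointSets,
      (((sigmaGraph H).numComponentsAfter T : ℤ) - 1) * m = u + T.card) ↔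
    (∀ i, ∀ T ∈ (H i).cutPointSets, (((H i).numComponentsAfter T : ℤ) - 1) * m = T.card) ∧
      u = ((Fintype.card ι : ℤ) - 1) * m := by
  classical
  constructor
  · intro h
    have hF (F : ∀ i, Finset (V i)) (hF : ∀ i, F i ∈ (H i).cutPointSets) :
        ∑ i, (((H i).numComponentsAfter (F i) : ℤ) - 1) * m + ((Fintype.card ι : ℤ) - 1) * m =
          u + ∑ i, ((F i).card : ℤ) := by
      rw [← numComponentsAfter_sigmaGraph_sub_one_mul,
        h _ (sigma_mem_cutPointSets_iff.mpr hF), Finset.card_sigma]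
      push_cast
      rfl
    have hone (i : ι) : (H i).numComponentsAfter ∅ = 1 :=
      numComponentsAfter_empty_of_connected (hH i)
    have hu : u = ((Fintype.card ι : ℤ) - 1) * m := by
      simpa [hone] using (hF (fun _ => ∅) fun i => empty_mem_cutPointSets _).symm
    refine ⟨fun i T hT => ?_, hu⟩
    have hi := hF (Function.update (fun _ => ∅) i T)
      ((Function.forall_update_iff _ fun i S => S ∈ (H i).cutPointSets).mpr
        ⟨hT, fun j _ => empty_mem_cutPointSets _⟩)
    rw [Finset.sum_eq_single i (fun j _ hj => by simp [hj, hone]) (by simp),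
      Finset.sum_eq_single i (fun j _ hj => by simp [hj]) (by simp), Function.update_self] at hi
    linarith
  · rintro ⟨hT, hu⟩ T hTmem
    obtain ⟨F, rfl⟩ := exists_sigma_eq T
    rw [numComponentsAfter_sigmaGraph_sub_one_mul, hu, Finset.card_sigma,
      Finset.sum_congr rfl fun i _ => hT i _ (sigma_mem_cutPointSets_iff.mp hTmem i)]
    push_cast
    ring

end Sigma

section JoinSigma

variable {U ι : Type*} {V : ι → Type*} {H : SimpleGraph U} {Hs : ∀ i, SimpleGraph (V i)}

theorem two_le_numComponentsAfter_sigmaGraph [Finite ι] [Nontrivial ι] [∀ i, Finite (V i)]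
    (hHs : ∀ i, (Hs i).Connected) {T : Finset (Σ i, V i)} (hT : T ∈ (sigmaGraph Hs).cutPointSets) :
    2 ≤ (sigmaGraph Hs).numComponentsAfter T := by
  cases nonempty_fintype ι
  obtain ⟨F, rfl⟩ := exists_sigma_eq T
  rw [numComponentsAfter_sigmaGraph]
  calc 2 ≤ Fintype.card ι := Fintype.one_lt_card
    _ = ∑ _ : ι, 1 := by simp
    _ ≤ ∑ i, (Hs i).numComponentsAfter (F i) := by
      gcongr with i
      exact numComponentsAfter_pos (hHs i) (sigma_mem_cutPointSets_iff.mp hT i)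

theorem forall_cutPointSets_joinGraph_sigmaGraph_iff [Fintype U] [Fintype ι] [Nontrivial ι]
    [∀ i, Fintype (V i)] (hH : H.Connected) (hHs : ∀ i, (Hs i).Connected) (m : ℤ) :
    (∀ T ∈ (H.joinGraph (sigmaGraph Hs)).cutPointSets,
      (((H.joinGraph (sigmaGraph Hs)).numComponentsAfter T : ℤ) - 1) * m = T.card) ↔
    (∀ i, ∀ T ∈ (Hs i).cutPointSets, (((Hs i).numComponentsAfter T : ℤ) - 1) * m = T.card) ∧
      (Fintype.card U : ℤ) = ((Fintype.card ι : ℤ) - 1) * m ∧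
      ∀ T ∈ H.cutPointSets, T ≠ ∅ →
        ((H.numComponentsAfter T : ℤ) - 1) * m = T.card + ∑ i, (Fintype.card (V i) : ℤ) := by
  have := hH.nonempty
  have : Nonempty (Σ i, V i) := nonempty_sigma.mpr ⟨Classical.arbitrary ι, (hHs _).nonempty⟩
  have hl : (∀ S ∈ H.cutPointSets, 2 ≤ H.numComponentsAfter S →
      ((H.numComponentsAfter S : ℤ) - 1) * m = S.card + Fintype.card (Σ i, V i)) ↔
      ∀ S ∈ H.cutPointSets, S ≠ ∅ →
        ((H.numComponentsAfter S : ℤ) - 1) * m = S.card + ∑ i, (Fintype.card (V i) : ℤ) := by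
    refine forall₂_congr fun S hS => ?_
    rw [two_le_numComponentsAfter_iff_ne_empty hH hS, Fintype.card_sigma, Nat.cast_sum]
  have hr : (∀ S ∈ (sigmaGraph Hs).cutPointSets, 2 ≤ (sigmaGraph Hs).numComponentsAfter S →
      (((sigmaGraph Hs).numComponentsAfter S : ℤ) - 1) * m = Fintype.card U + S.card) ↔
      ∀ S ∈ (sigmaGraph Hs).cutPointSets,
        (((sigmaGraph Hs).numComponentsAfter S : ℤ) - 1) * m = Fintype.card U + S.card :=
    forall₂_congr fun S hS => forall_prop_of_true (two_le_numComponentsAfter_sigmaGraph hHs hS)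
  rw [forall_cutPointSets_joinGraph_iff, hl, hr, forall_cutPointSets_sigmaGraph_iff hHs,
    and_comm, and_assoc]

end JoinSigma

end BinomialEdgeIdeal

open SimpleGraph BinomialEdgeIdeal in
theorem theorem4p6_general (K : Type*) [Field K] {V U ι : Type*} {W : ι → Type*} [Fintype V]
    [Nontrivial V] [Fintype U] [Fintype ι] [Nontrivial ι] [∀ i, Fintype (W i)]
    (G₁ : SimpleGraph V) (H : SimpleGraph U) (Hs : ∀ i, SimpleGraph (W i)) (hG₁ : G₁.Connected)
    (hH : H.Connected) (hHs : ∀ i, (Hs i).Connected)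
    (hcard : Fintype.card V ≤ Fintype.card U + ∑ i, Fintype.card (W i)) :
    (pairBinomialEdgeIdeal K G₁ (H.joinGraph (sigmaGraph Hs))).IsUnmixed ↔
      (∀ i, (pairBinomialEdgeIdeal K G₁ (Hs i)).IsUnmixed) ∧
      G₁ = ⊤ ∧
      (Fintype.card U : ℤ) = ((Fintype.card ι : ℤ) - 1) * ((Fintype.card V : ℤ) - 1) ∧
      (∀ T ∈ H.cutPointSets, T ≠ ∅ →
        ((H.numComponentsAfter T : ℤ) - 1) * ((Fintype.card V : ℤ) - 1) =
          (T.card : ℤ) + ∑ i, (Fintype.card (W i) : ℤ)) := by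
  have := hH.nonempty
  have : Nonempty (Σ i, W i) := nonempty_sigma.mpr ⟨Classical.arbitrary ι, (hHs _).nonempty⟩
  have hG : (H.joinGraph (sigmaGraph Hs)).Connected := joinGraph_connected H (sigmaGraph Hs)
  have hcard' : Fintype.card V ≤ Fintype.card (U ⊕ Σ i, W i) := by simpa using hcard
  rw [and_left_comm, ← and_iff_right_of_imp (eq_top_of_isUnmixed (K := K) hG₁ hG hcard')]
  refine and_congr_right ?_
  rintro rfl
  rw [isUnmixed_pairBinomialEdgeIdeal_top_iff hG,
    forall_congr' fun i => isUnmixed_pairBinomialEdgeIdeal_top_iff (hHs i),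
    forall_cutPointSets_joinGraph_sigmaGraph_iff hH hHs]

theorem theorem4p6 (K : Type*) [Field K] {m t r : ℕ} {n : Fin r → ℕ}
    (G₁ : SimpleGraph (Fin m)) (H : SimpleGraph (Fin t))
    (Hs : ∀ i : Fin r, SimpleGraph (Fin (n i)))
    (hG₁ : G₁.Connected) (hH : H.Connected) (hHs : ∀ i, (Hs i).Connected)
    (hr : 2 ≤ r) (hm : 2 ≤ m) (hmn : m ≤ t + ∑ i, n i)
    (hn : ∀ i, n i = 1 ∨ m ≤ n i) :
    (SimpleGraph.pairBinomialEdgeIdeal K G₁ (H.joinGraph (SimpleGraph.sigmaGraph Hs))).IsUnmixed ↔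
      (∀ i, (SimpleGraph.pairBinomialEdgeIdeal K G₁ (Hs i)).IsUnmixed) ∧
      G₁ = ⊤ ∧
      (t : ℤ) = ((r : ℤ) - 1) * ((m : ℤ) - 1) ∧
      (∀ T ∈ H.cutPointSets, T ≠ ∅ →
        ((H.numComponentsAfter T : ℤ) - 1) * ((m : ℤ) - 1) = (T.card : ℤ) + ∑ i, (n i : ℤ)) := by
  have := Fin.nontrivial_iff_two_le.mpr hm
  have := Fin.nontrivial_iff_two_le.mpr hr
  simpa using theorem4p6_general K G₁ H Hs hG₁ hH hHs (by simpa using hmn)
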